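/- Let $p$ be a prime number, $F$ a finite extension of $\mathbb{Q}_p$ with ring of integers $\mathcal{O}_F$, and $E$ a field of characteristic $p$. Consider the subgroups $$U=\left\{\begin{pmatrix}1&x\\0&1\end{pmatrix} : x\in\mathcal{O}_F\right\},\qquad \Gamma=\left\{\begin{pmatrix}a&0\\0&1\end{pmatrix} : a\in 1+p\mathcal{O}_F\right\}$$ of $\mathrm{GL}_2(F)$, with the topology induced by that of $F$. Let $$E[[U]]=\varprojlim_{U'}E[U/U']$$ be the Iwasawa algebra of $U$ over $E$, where $U'$ runs through the open subgroups of $U$, with its projective limit topology (each $E[U/U']$ being discrete). The group $\Gamma$ acts on $U$ by conjugation, $u\mapsto\gamma u\gamma^{-1}$, and hence acts on $E[[U]]$ by $E$-algebra automorphisms. Let $\Gamma'$ be an open subgroup of $\Gamma$ and let $I$ be an ideal of $E[[U]]$ that is stable under $\Gamma'$, i.e. $\gamma(x)\in I$ for all $\gamma\in\Gamma'$ and $x\in I$. Then: 1. If $I\neq 0$, then $I$ is open in $E[[U]]$. 2. If $I\neq E[[U]]$, then the height of $I$ is $0$ or $[F:\mathbb{Q}_p]$. 3. The height of $I$ is $0$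 if and only if $I=0$; and if $I\neq E[[U]]$, the height of $I$ is $[F:\mathbb{Q}_p]$ if and only if $I$ is open in $E[[U]]$. -/

import Mathlib

noncomputable section

namespace Iwasawa

section CompletedGroupAlgebra

variable (E : Type*) [Field E] (G : Type*) [CommGroup G] [TopologicalSpace G]

/-- The transition map `E[G/N] → E[G/M]` for open subgroups `N ≤ M` of `G`. -/
def transition {N M : OpenSubgroup G} (h : N ≤ M) :
    MonoidAlgebra E (G ⧸ N.toSubgroup) →ₐ[E] MonoidAlgebra E (G ⧸ M.toSubgroup) :=
  MonoidAlgebra.mapDomainAlgHom E E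
    (QuotientGroup.map N.toSubgroup M.toSubgroup (MonoidHom.id G) h)

/-- The completed group algebra `E[[G]] = lim E[G/N]`, the limit being over all open subgroups `N`
of the commutative topological group `G`: the compatible families in the product of the
group algebras `E[G/N]`. -/
def IwasawaAlgebra :
    Subalgebra E ((N : OpenSubgroup G) → MonoidAlgebra E (G ⧸ N.toSubgroup)) where
  carrier := {x | ∀ (N M : OpenSubgroup G) (h : N ≤ M), transition E G h (x N) = x M}
  mul_mem' hx hy N M h := by simp [hx N M h, hy N M h]
  add_mem' hx hy N M h := by simp [hx N M h, hy N M h]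
  algebraMap_mem' r N M h := by
    simp only [Pi.algebraMap_apply]
    exact (transition E G h).commutes r

/-- The projective limit topology on `E[[G]]`, every `E[G/N]` being discrete. -/
instance : TopologicalSpace (IwasawaAlgebra E G) :=
  ⨅ N : OpenSubgroup G, TopologicalSpace.induced (fun x => x.1 N) ⊥

variable {G} {H : Type*} [CommGroup H] [TopologicalSpace H]

/-- The algebra morphism `E[[G]] → E[[H]]` induced by a continuous morphism `φ : G → H`: its
component at `N` is the composite `E[[G]] → E[G/φ⁻¹(N)] → E[H/N]`. -/
def IwasawaAlgebra.map (φ : G →ₜ* H) : IwasawaAlgebra E G →ₐ[E] IwasawaAlgebra E H where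
  toFun x := ⟨fun N => MonoidAlgebra.mapDomainAlgHom E E
      (QuotientGroup.map (N.comap φ.toMonoidHom φ.continuous_toFun).toSubgroup N.toSubgroup
        φ.toMonoidHom (OpenSubgroup.toSubgroup_comap N _ _).le) (x.1 (N.comap φ.toMonoidHom φ.continuous_toFun)), by
    intro N M h
    have h' : N.comap φ.toMonoidHom φ.continuous_toFun ≤
        M.comap φ.toMonoidHom φ.continuous_toFun := fun g hg => h hg
    beta_reduce
    rw [← x.2 _ _ h']
    unfold transition
    rw [← AlgHom.comp_apply, ← AlgHom.comp_apply]
    rw [← MonoidAlgebra.mapDomainAlgHom_comp, ← MonoidAlgebra.mapDomainAlgHom_comp]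
    congr 2
    apply QuotientGroup.monoidHom_ext
    ext g
    rfl⟩
  map_one' := by ext1; funext N; exact map_one _
  map_mul' x y := by ext1; funext N; exact map_mul _ _ _
  map_zero' := by ext1; funext N; exact map_zero _
  map_add' x y := by ext1; funext N; exact map_add _ _ _
  commutes' r := by ext1; funext N; exact AlgHom.commutes _ _

end CompletedGroupAlgebra

section Matrices

variable (p : ℕ) [Fact p.Prime] (F : Type*) [NormedField F] [Algebra ℤ_[p] F]

/-- The matrix `(1 x; 0 1)` in `GL₂(F)`. -/
def unip {F : Type*} [Field F] (x : F) : GL (Fin 2) F :=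
  Matrix.GeneralLinearGroup.mkOfDetNeZero !![1, x; 0, 1] (by simp)

/-- The matrix `(a 0; 0 1)` in `GL₂(F)`. -/
def diag {F : Type*} [Field F] (a : Fˣ) : GL (Fin 2) F :=
  Matrix.GeneralLinearGroup.mkOfDetNeZero !![(a : F), 0; 0, 1] (by simp)

theorem unip_mul {F : Type*} [Field F] (x y : F) : unip x * unip y = unip (x + y) := by
  ext i j
  fin_cases i <;> fin_cases j <;>
    simp [unip, Matrix.GeneralLinearGroup.mkOfDetNeZero, Matrix.mul_apply, add_comm]

theorem unip_zero {F : Type*} [Field F] : unip (0 : F) = 1 := by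
  ext i j
  fin_cases i <;> fin_cases j <;> simp [unip, Matrix.GeneralLinearGroup.mkOfDetNeZero]

theorem diag_mul {F : Type*} [Field F] (a b : Fˣ) : diag a * diag b = diag (a * b) := by
  ext i j
  fin_cases i <;> fin_cases j <;>
    simp [diag, Matrix.GeneralLinearGroup.mkOfDetNeZero, Matrix.mul_apply]

theorem diag_one {F : Type*} [Field F] : diag (1 : Fˣ) = 1 := by
  ext i j
  fin_cases i <;> fin_cases j <;> simp [diag, Matrix.GeneralLinearGroup.mkOfDetNeZero]

theorem diag_mul_unip {F : Type*} [Field F] (a : Fˣ) (x : F) :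
    diag a * unip x = unip (a * x) * diag a := by
  ext i j
  fin_cases i <;> fin_cases j <;>
    simp [diag, unip, Matrix.GeneralLinearGroup.mkOfDetNeZero, Matrix.mul_apply]

/-- The ring of integers `O_F`: the integral closure of `ℤ_p` in `F`. -/
abbrev OF : Subalgebra ℤ_[p] F := integralClosure ℤ_[p] F

/-- The group `U` of the matrices `(1 x; 0 1)` with `x ∈ O_F`. Its topology is induced by that of
`GL₂(F)`. -/
def U : Subgroup (GL (Fin 2) F) where
  carrier := {g | ∃ x ∈ OF p F, g = unip x}
  mul_mem' := by
    rintro _ _ ⟨x, hx, rfl⟩ ⟨y, hy, rfl⟩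
    exact ⟨x + y, add_mem hx hy, unip_mul x y⟩
  one_mem' := ⟨0, zero_mem _, unip_zero.symm⟩
  inv_mem' := by
    rintro _ ⟨x, hx, rfl⟩
    refine ⟨-x, neg_mem hx, inv_eq_of_mul_eq_one_right ?_⟩
    rw [unip_mul, add_neg_cancel, unip_zero]

instance : CommGroup (U p F) :=
  { (inferInstance : Group (U p F)) with
    mul_comm := by
      rintro ⟨_, x, hx, rfl⟩ ⟨_, y, hy, rfl⟩
      apply Subtype.ext
      change unip x * unip y = unip y * unip x
      rw [unip_mul, unip_mul, add_comm] }

variable {F} in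
theorem isUnit_one_add_p_mul (x : OF p F) : IsUnit (1 + (p : OF p F) * x) := by
  by_contra hx
  obtain ⟨m, hm, hxm⟩ := exists_max_ideal_of_mem_nonunits hx
  have h1 : (m.comap (algebraMap ℤ_[p] (OF p F))).IsMaximal :=
    Ideal.isMaximal_comap_of_isIntegral_of_isMaximal m
  have h2 : (p : ℤ_[p]) ∈ m.comap (algebraMap ℤ_[p] (OF p F)) := by
    rw [IsLocalRing.eq_maximalIdeal h1]
    exact PadicInt.p_nonunit
  have h3 : (p : OF p F) ∈ m := by simpa using h2
  exact hm.ne_top ((Ideal.eq_top_iff_one m).2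
    ((Ideal.add_mem_iff_left m (m.mul_mem_right x h3)).1 hxm))

/-- The group `Γ` of the matrices `(a 0; 0 1)` with `a ∈ 1 + pO_F`. Its topology is induced by that
of `GL₂(F)`. -/
def Γ : Subgroup (GL (Fin 2) F) where
  carrier := {g | ∃ a : Fˣ, (∃ x ∈ OF p F, (a : F) = 1 + p * x) ∧ g = diag a}
  mul_mem' := by
    rintro _ _ ⟨a, ⟨x, hx, hax⟩, rfl⟩ ⟨b, ⟨y, hy, hby⟩, rfl⟩
    refine ⟨a * b, ⟨x + y + p * (x * y), ?_, ?_⟩, diag_mul a b⟩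
    · exact add_mem (add_mem hx hy) (mul_mem (natCast_mem _ p) (mul_mem hx hy))
    · rw [Units.val_mul, hax, hby]; ring
  one_mem' := ⟨1, ⟨0, zero_mem _, by simp⟩, diag_one.symm⟩
  inv_mem' := by
    rintro _ ⟨a, ⟨x, hx, hax⟩, rfl⟩
    obtain ⟨v, hv⟩ := isUnit_one_add_p_mul p (⟨x, hx⟩ : OF p F)
    have hva : ((v : OF p F) : F) = a := by rw [hv, hax]; simp
    have h1 : (a : F) * ((v⁻¹ : (OF p F)ˣ) : OF p F) = 1 := by
      rw [← hva]; exact_mod_cast congrArg Subtype.val v.mul_inv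
    have h2 : ((a⁻¹ : Fˣ) : F) = ((v⁻¹ : (OF p F)ˣ) : OF p F) := by
      rw [Units.val_inv_eq_inv_val]; exact inv_eq_of_mul_eq_one_right h1
    refine ⟨a⁻¹, ⟨-(x * ((v⁻¹ : (OF p F)ˣ) : OF p F)), neg_mem (mul_mem hx (Subtype.property _)),
      ?_⟩, inv_eq_of_mul_eq_one_right (by rw [diag_mul, mul_inv_cancel, diag_one])⟩
    rw [h2]
    linear_combination h1 - (((v⁻¹ : (OF p F)ˣ) : OF p F) : F) * hax

theorem conj_mem (γ : Γ p F) (u : U p F) :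
    (γ : GL (Fin 2) F) * u * (γ : GL (Fin 2) F)⁻¹ ∈ U p F := by
  obtain ⟨_, a, ⟨x, hx, hax⟩, rfl⟩ := γ
  obtain ⟨_, y, hy, rfl⟩ := u
  refine ⟨a * y, ?_, ?_⟩
  · rw [hax]
    exact mul_mem (add_mem (one_mem _) (mul_mem (natCast_mem _ p) hx)) hy
  · change diag a * unip y * (diag a)⁻¹ = _
    rw [diag_mul_unip, mul_inv_cancel_right]

/-- The conjugation `u ↦ γ u γ⁻¹` of `U` by an element `γ` of `Γ`. -/
def conj (γ : Γ p F) : U p F →ₜ* U p F where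
  toFun u := ⟨(γ : GL (Fin 2) F) * u * (γ : GL (Fin 2) F)⁻¹, conj_mem p F γ u⟩
  map_one' := by apply Subtype.ext; simp
  map_mul' u v := by
    apply Subtype.ext
    change (γ : GL (Fin 2) F) * ((u : GL (Fin 2) F) * v) * (γ : GL (Fin 2) F)⁻¹ =
      ((γ : GL (Fin 2) F) * u * (γ : GL (Fin 2) F)⁻¹) *
        ((γ : GL (Fin 2) F) * v * (γ : GL (Fin 2) F)⁻¹)
    group
  continuous_toFun :=
    ((continuous_const.mul continuous_subtype_val).mul continuous_const).subtype_mk _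

end Matrices

end Iwasawa

end

-- Write `R = E[[U]]`, with maximal ideal `m`, and `d = [F : ℚ_p]`. As `U` is isomorphic to `ℤ_p ^
-- d`, the ring `R` is a power series ring in `d` variables (`IsPadicBasis.ringEquiv`): a noetherian
-- local domain of dimension `d`, in which every power of `m` contains the kernel of a projection to
-- some `E[U/U']`. All the claims follow once a nonzero stable ideal `I` is known to contain a power
-- of `m`, that is, once no nonmaximal prime `Q` contains `I`.
--
-- Suppose that such a `Q` exists. By `IsLocalRing.exists_archimedean_valuation`, there is a
-- morphism `φ` from `R` to a field `L` that kills `Q` but not `m`, and an archimedean valuation on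
-- `L` that is less than 1 on `φ(m)`. Then `χ(u) = φ(u)` is a continuous nontrivial character of
-- `U`, congruent to 1 modulo the maximal ideal of the valuation. View a nonzero `f ∈ I` as an
-- `E`-valued measure on `U`. Stability gives `∫ χ(u) χ(ψ_y(u)) df(u) = 0` for all `y ∈ O_F`, where
-- `ψ_y(u) = u⁻¹ γ u γ⁻¹` amounts to multiplication by `p ^ (r + 1) y` on `O_F`. Since `ψ_y` is
-- additive in `y`, the functions `χ ∘ ψ_y` span an algebra; it separates points because there are
-- no nontrivial `p`-power roots of unity in characteristic `p`.
--
-- By Kaplansky's theorem (`Valuation.exists_approx_indicator`), this algebra contains a function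
-- `w` congruent to the indicator of any given clopen set `C`. Hence `0 = ∫ χ w df` is congruent to
-- `f(C)`. For a suitable coset `C`, `f(C)` is a nonzero element of `E`, so it has valuation 1: a
-- contradiction (`exists_maximalIdeal_pow_le`).

universe u

/-! ### Archimedean valuations dominating a noetherian local ring. -/

section ArchimedeanValuation

variable {K : Type*} [Field K]

/-- The elements whose powers have denominators bounded by `y`: a coarsening of `V`. -/
def ValuationSubring.powBounded (V : ValuationSubring K) {y : K} (hy : V.valuation y ≤ 1) :
    ValuationSubring K where
  carrier := {x | ∀ k : ℕ, V.valuation x ^ k * V.valuation y ≤ 1}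
  mul_mem' := by
    intro a b ha hb k
    have key : ∀ a b : K, (∀ k : ℕ, V.valuation b ^ k * V.valuation y ≤ 1) →
        V.valuation a ≤ V.valuation b → V.valuation (a * b) ^ k * V.valuation y ≤ 1 := by
      intro a b hb hab
      refine le_trans ?_ (hb (2 * k))
      rw [map_mul, pow_mul, sq]
      gcongr
    rcases le_total (V.valuation a) (V.valuation b) with h | h
    · exact key a b hb h
    · rw [mul_comm a b]; exact key b a ha h
  one_mem' k := by simpa using hy
  add_mem' := by
    intro a b ha hb k
    rcases le_max_iff.1 (V.valuation.map_add a b) with h | h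
    · exact le_trans (by gcongr) (ha k)
    · exact le_trans (by gcongr) (hb k)
  zero_mem' k := by
    rcases k with _ | k
    · simpa using hy
    · simp
  neg_mem' := by
    intro a ha k
    simpa using ha k
  mem_or_inv_mem' := by
    have key : ∀ x : K, V.valuation x ≤ 1 → ∀ k : ℕ, V.valuation x ^ k * V.valuation y ≤ 1 :=
      fun x hx k => mul_le_one' (pow_le_one' hx k) hy
    intro x
    rcases V.mem_or_inv_mem x with h | h
    · exact Or.inl (key x ((V.valuation_le_one_iff x).2 h))
    · exact Or.inr (key x⁻¹ ((V.valuation_le_one_iff _).2 h))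

theorem ValuationSubring.mem_powBounded {V : ValuationSubring K} {y : K}
    (hy : V.valuation y ≤ 1) {x : K} :
    x ∈ V.powBounded hy ↔ ∀ k : ℕ, V.valuation x ^ k * V.valuation y ≤ 1 := Iff.rfl

theorem ValuationSubring.le_powBounded {V : ValuationSubring K} {y : K}
    (hy : V.valuation y ≤ 1) : V ≤ V.powBounded hy := fun x hx k =>
  mul_le_one' (pow_le_one' ((V.valuation_le_one_iff x).2 hx) k) hy

/-- An element lies in the maximal ideal exactly when its inverse fails to be power bounded. This
compares every topologically small element with the single element `y`. -/
theorem ValuationSubring.valuation_powBounded_lt_one_iff {V : ValuationSubring K} {y : K}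
    (hy : V.valuation y ≤ 1) {x : K} (hx : x ≠ 0) :
    (V.powBounded hy).valuation x < 1 ↔ ∃ k : ℕ, V.valuation x ^ k < V.valuation y := by
  have h1 : (V.powBounded hy).valuation x < 1 ↔ ¬ (V.powBounded hy).valuation x⁻¹ ≤ 1 := by
    have : (V.powBounded hy).valuation x ≠ 0 := by simpa using hx
    rw [map_inv₀, inv_le_one₀ (zero_lt_iff.2 this), not_le]
  have hvx : V.valuation x ≠ 0 := by simpa using hx
  rw [h1, ValuationSubring.valuation_le_one_iff, mem_powBounded, not_forall]
  refine exists_congr fun k => ?_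
  rw [not_le, map_inv₀, inv_pow, ← div_eq_inv_mul,
    one_lt_div₀ (pow_pos (zero_lt_iff.2 hvx) k)]

open IsLocalRing in
/-- Every nonmaximal prime of a noetherian local ring `R` is killed by a morphism to a field with
an archimedean valuation that is dominating `R` and that is nontrivial on it. -/
theorem IsLocalRing.exists_archimedean_valuation {R : Type u} [CommRing R] [IsNoetherianRing R]
    [IsLocalRing R] (P : Ideal R) [hP : P.IsPrime] (hPm : P ≠ maximalIdeal R) :
    ∃ (L : Type u) (_ : Field L) (φ : R →+* L) (Γ₀ : Type u)
      (_ : LinearOrderedCommGroupWithZero Γ₀) (v : Valuation L Γ₀),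
      (∀ a ∈ P, φ a = 0) ∧ (∃ a ∈ maximalIdeal R, φ a ≠ 0) ∧ (∀ a, v (φ a) ≤ 1) ∧
      (∀ a ∈ maximalIdeal R, v (φ a) < 1) ∧
      ∀ s γ, v s < 1 → γ ≠ 0 → ∃ k : ℕ, v s ^ k < γ := by
  -- By maximality, the only primes containing `Q` are `Q` and the maximal ideal, so `R ⧸ Q` has
  -- dimension one.
  obtain ⟨Q, ⟨hPQ, hQ, hQm⟩, hmax⟩ := WellFounded.has_min
    (wellFounded_gt : WellFounded ((· > ·) : Ideal R → Ideal R → Prop))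
    {Q : Ideal R | P ≤ Q ∧ Q.IsPrime ∧ Q ≠ maximalIdeal R} ⟨P, le_rfl, hP, hPm⟩
  let L := FractionRing (R ⧸ Q)
  let φ : R →+* L := (algebraMap (R ⧸ Q) L).comp (Ideal.Quotient.mk Q)
  have hφ : ∀ a, φ a = 0 ↔ a ∈ Q := by
    intro a
    rw [RingHom.comp_apply, map_eq_zero_iff _ (IsFractionRing.injective (R ⧸ Q) L),
      Ideal.Quotient.eq_zero_iff_mem]
  obtain ⟨y, hym, hyQ⟩ : ∃ y ∈ maximalIdeal R, y ∉ Q := by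
    by_contra! h
    exact hQm (le_antisymm (le_maximalIdeal hQ.ne_top) h)
  -- Any valuation ring dominating the image of `R`. It may have higher rank, hence the coarsening
  -- `V'` below.
  obtain ⟨V, hV1, hV2⟩ := Ideal.image_subset_nonunits_valuationSubring
    ((maximalIdeal R).map φ.rangeRestrict) (by
      rw [Ne, Ideal.eq_top_iff_one, Ideal.mem_map_iff_of_surjective _ φ.rangeRestrict_surjective]
      rintro ⟨a, ha, ha1⟩
      have h1 : φ (a - 1) = 0 := by
        rw [map_sub, map_one, sub_eq_zero]
        exact congrArg Subtype.val ha1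
      have h2 : a - 1 ∈ maximalIdeal R := le_maximalIdeal hQ.ne_top ((hφ _).1 h1)
      exact (Ideal.ne_top_iff_one _).1 (maximalIdeal.isMaximal R).ne_top
        (by simpa using sub_mem ha h2))
  have hle : ∀ a, V.valuation (φ a) ≤ 1 := fun a =>
    (V.valuation_le_one_iff _).2 (hV1 ⟨a, rfl⟩)
  have hlt : ∀ a ∈ maximalIdeal R, V.valuation (φ a) < 1 := fun a ha =>
    (V.mem_nonunits_iff).1 (hV2 ⟨φ.rangeRestrict a, Ideal.mem_map_of_mem _ ha, rfl⟩)
  -- Only the maximal ideal contains both `Q` and `b`, so some power of `a` is a multiple of `b`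
  -- modulo `Q`.
  have hdiv : ∀ a ∈ maximalIdeal R, ∀ b, φ b ≠ 0 →
      ∃ k : ℕ, V.valuation (φ a) ^ k ≤ V.valuation (φ b) := by
    intro a ha b hb
    have h1 : a ∈ (Ideal.span {b} ⊔ Q).radical := by
      rw [Ideal.radical_eq_sInf, Ideal.mem_sInf]
      rintro J ⟨hJ, hJp⟩
      by_cases hJm : J = maximalIdeal R
      · exact hJm ▸ ha
      have hQJ : Q ≤ J := le_sup_right.trans hJ
      refine absurd ?_ (hmax J ⟨hPQ.trans hQJ, hJp, hJm⟩)
      refine lt_of_le_of_ne hQJ ?_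
      rintro rfl
      exact hb ((hφ b).2 (hJ (le_sup_left (α := Ideal R) (Ideal.mem_span_singleton_self b))))
    obtain ⟨k, hk⟩ := h1
    obtain ⟨c, hc, q, hq, hcq⟩ := Submodule.mem_sup.1 hk
    obtain ⟨r, rfl⟩ := Ideal.mem_span_singleton'.1 hc
    refine ⟨k, ?_⟩
    rw [← map_pow, ← map_pow, ← hcq, map_add, (hφ q).2 hq, add_zero, map_mul, map_mul]
    exact mul_le_of_le_one_left' (hle r)
  have hy0 : φ y ≠ 0 := fun h => hyQ ((hφ y).1 h)
  let V' := V.powBounded (hle y)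
  have hVV' : V ≤ V' := ValuationSubring.le_powBounded _
  refine ⟨L, inferInstance, φ, V'.ValueGroup, inferInstance, V'.valuation,
    fun a ha => (hφ a).2 (hPQ ha), ⟨y, hym, hy0⟩, fun a => (V'.valuation_le_one_iff _).2
      (hVV' ((V.valuation_le_one_iff _).1 (hle a))), fun a ha => ?_, fun s γ hs hγ => ?_⟩
  · by_cases ha0 : φ a = 0
    · simp [ha0]
    rw [ValuationSubring.valuation_powBounded_lt_one_iff _ ha0]
    obtain ⟨k, hk⟩ := hdiv a ha y hy0
    refine ⟨k + 1, lt_of_lt_of_le ?_ hk⟩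
    rw [pow_succ]
    exact mul_lt_of_lt_one_right (pow_pos (zero_lt_iff.2 (by simpa using ha0)) k) (hlt a ha)
  · by_cases hs0 : s = 0
    · exact ⟨1, by simpa [hs0] using zero_lt_iff.2 hγ⟩
    -- A power of `s` lies below `y`, a power of `y` lies below the numerator `b`, and denominators
    -- have value at most 1. One more factor `s` makes the inequality strict for `V'`.
    obtain ⟨j, hj⟩ := (ValuationSubring.valuation_powBounded_lt_one_iff (hle y) hs0).1 hs
    obtain ⟨t, rfl⟩ := V'.valuation_surjective γ
    obtain ⟨b, c, hc, rfl⟩ := IsFractionRing.div_surjective (A := R ⧸ Q) t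
    obtain ⟨b, rfl⟩ := Ideal.Quotient.mk_surjective b
    obtain ⟨c, rfl⟩ := Ideal.Quotient.mk_surjective c
    change V'.valuation (φ b / φ c) ≠ 0 at hγ
    change ∃ k : ℕ, V'.valuation s ^ k < V'.valuation (φ b / φ c)
    have hbc : φ b ≠ 0 ∧ φ c ≠ 0 := by simpa using hγ
    obtain ⟨k, hk⟩ := hdiv y hym b hbc.1
    have h1 : V.valuation (s ^ (j * k)) ≤ V.valuation (φ b / φ c) := by
      rw [map_pow, pow_mul, map_div₀]
      refine (pow_le_pow_left' hj.le k).trans (hk.trans ?_)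
      rw [le_div_iff₀ (zero_lt_iff.2 (by simpa using hbc.2))]
      exact mul_le_of_le_one_right' (hle c)
    have h2 : V'.valuation (s ^ (j * k)) ≤ V'.valuation (φ b / φ c) := by
      have := ValuationSubring.monotone_mapOfLE V V' hVV' h1
      simpa only [ValuationSubring.mapOfLE_valuation_apply] using this
    refine ⟨j * k + 1, ?_⟩
    rw [pow_succ, ← map_pow]
    exact lt_of_le_of_lt (mul_le_mul_left h2 _) (mul_lt_of_lt_one_right (zero_lt_iff.2 hγ) hs)

end ArchimedeanValuation

/-! ### Kaplansky's Stone–Weierstrass theorem. -/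

namespace Valuation

section Kaplansky

open Topology

variable {L : Type*} [Field L] {Γ₀ : Type*} [LinearOrderedCommGroupWithZero Γ₀] (v : Valuation L Γ₀)
  {X : Type*} [TopologicalSpace X]

/-- Continuity of a function to a valued field. -/
def ContinuousMod (f : X → L) : Prop :=
  ∀ γ : Γ₀, γ ≠ 0 → ∀ x, ∀ᶠ z in 𝓝 x, v (f z - f x) < γ

variable {v} [CompactSpace X]

theorem ContinuousMod.exists_finset {f : X → L} (hf : v.ContinuousMod f) {γ : Γ₀} (hγ : γ ≠ 0) :
    ∃ T : Finset X, ∀ z, ∃ t ∈ T, v (f z - f t) < γ := by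
  obtain ⟨T, -, hT⟩ := isCompact_univ.elim_nhds_subcover (fun x : X => {z | v (f z - f x) < γ})
    (fun x _ => hf γ hγ x)
  refine ⟨T, fun z => ?_⟩
  simpa using hT (Set.mem_univ z)

/-- By the ultrametric inequality, all values above `γ` are already attained on a finite net of
precision `γ`. This finiteness drives the induction in `exists_separating_of_ne_zero`. -/
theorem ContinuousMod.finite_values {f : X → L} (hf : v.ContinuousMod f) {γ : Γ₀} (hγ : γ ≠ 0) :
    {δ | γ < δ ∧ ∃ z, v (f z) = δ}.Finite := by
  obtain ⟨T, hT⟩ := hf.exists_finset hγ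
  refine (T.image fun t => v (f t)).finite_toSet.subset ?_
  rintro _ ⟨hδ, z, rfl⟩
  obtain ⟨t, ht, htz⟩ := hT z
  simp only [Finset.coe_image, Set.mem_image, Finset.mem_coe]
  refine ⟨t, ht, v.map_eq_of_sub_lt ?_⟩
  rw [v.map_sub_swap]
  exact htz.trans hδ

/-- The exponent is locally uniform, hence uniform by compactness: near a zero of `f` the first
power is enough, and elsewhere `v ∘ f` is locally constant. -/
theorem ContinuousMod.exists_pow_lt
    (harch : ∀ s γ, v s < 1 → γ ≠ 0 → ∃ k : ℕ, v s ^ k < γ) {f : X → L} (hf : v.ContinuousMod f)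
    {γ : Γ₀} (hγ : γ ≠ 0) : ∃ N : ℕ, ∀ z, v (f z) < 1 → v (f z) ^ N < γ := by
  have pow_lt : ∀ (a : Γ₀) (m n : ℕ), a < 1 → m ≤ n → a ^ m < γ → a ^ n < γ :=
    fun a m n ha hmn h => (pow_le_pow_right_of_le_one' ha.le hmn).trans_lt h
  suffices h : ∃ N : ℕ, ∀ n ≥ N, ∀ z ∈ (Set.univ : Set X), v (f z) < 1 → v (f z) ^ n < γ by
    obtain ⟨N, hN⟩ := h
    exact ⟨N, fun z => hN N le_rfl z trivial⟩
  refine isCompact_univ.induction_on (p := fun s => ∃ N : ℕ, ∀ n ≥ N, ∀ z ∈ s,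
    v (f z) < 1 → v (f z) ^ n < γ) ⟨0, by simp⟩ ?_ ?_ ?_
  · rintro s t hst ⟨N, hN⟩
    exact ⟨N, fun n hn z hz => hN n hn z (hst hz)⟩
  · rintro s t ⟨N, hN⟩ ⟨M, hM⟩
    refine ⟨max N M, fun n hn z hz => ?_⟩
    rcases hz with hz | hz
    · exact hN n ((le_max_left _ _).trans hn) z hz
    · exact hM n ((le_max_right _ _).trans hn) z hz
  · intro x _
    by_cases hx0 : f x = 0
    · refine ⟨_, nhdsWithin_le_nhds (hf γ hγ x), 1, fun n hn z hz hz1 => ?_⟩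
      refine pow_lt _ _ _ hz1 hn ?_
      simpa [hx0] using hz
    · have hloc := hf (v (f x)) (by simpa using hx0) x
      by_cases hx1 : v (f x) < 1
      · obtain ⟨N, hN⟩ := harch (f x) γ hx1 hγ
        refine ⟨_, nhdsWithin_le_nhds hloc, N, fun n hn z hz hz1 => ?_⟩
        rw [v.map_eq_of_sub_lt hz]
        exact pow_lt _ _ _ hx1 hn hN
      · refine ⟨_, nhdsWithin_le_nhds hloc, 0, fun n _ z hz hz1 => ?_⟩
        rw [v.map_eq_of_sub_lt hz] at hz1
        exact absurd hz1 hx1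

theorem map_prod_le_one {ι : Type*} (T : Finset ι) (g : ι → L) (h : ∀ t ∈ T, v (g t) ≤ 1) :
    v (∏ t ∈ T, g t) ≤ 1 := by
  rw [map_prod]
  exact Finset.prod_le_one' h

theorem map_prod_lt_one {ι : Type*} {T : Finset ι} {g : ι → L} (h : ∀ t ∈ T, v (g t) ≤ 1)
    {t : ι} (ht : t ∈ T) (hlt : v (g t) < 1) : v (∏ t ∈ T, g t) < 1 := by
  classical
  rw [← Finset.mul_prod_erase T g ht, map_mul]
  exact mul_lt_one_of_lt_of_le hlt
    (map_prod_le_one _ _ fun s hs => h s (Finset.mem_of_mem_erase hs))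

theorem map_mul_sub_one_lt_one {a b : L} (ha : v (a - 1) < 1) (hb : v (b - 1) < 1) :
    v (a * b - 1) < 1 := by
  have hb1 : v b = 1 := by
    simpa using v.map_eq_of_sub_lt (x := 1) (y := b) (by simpa using hb)
  have : a * b - 1 = (a - 1) * b + (b - 1) := by ring
  rw [this]
  refine v.map_add_lt ?_ hb
  rwa [map_mul, hb1, mul_one]

theorem map_prod_sub_one_lt_one {ι : Type*} (T : Finset ι) (g : ι → L)
    (h : ∀ t ∈ T, v (g t - 1) < 1) : v (∏ t ∈ T, g t - 1) < 1 := by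
  classical
  induction T using Finset.induction_on with
  | empty => simp
  | insert a T ha ih =>
    rw [Finset.prod_insert ha]
    exact map_mul_sub_one_lt_one (h a (Finset.mem_insert_self a T))
      (ih fun t ht => h t (Finset.mem_insert_of_mem ht))

variable (harch : ∀ s γ, v s < 1 → γ ≠ 0 → ∃ k : ℕ, v s ^ k < γ) (W : Subalgebra L (X → L))
  (hW : ∀ f ∈ W, v.ContinuousMod f)

include harch hW

/-- In an algebra of continuous functions, a function that separates two points can be replaced by
one that is bounded by `1` and separates them modulo the maximal ideal. -/
theorem exists_separating_of_ne_zero (x y : X) (f : X → L) (hf : f ∈ W) (hx : f x = 0)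
    (hy : f y ≠ 0) :
    ∃ g ∈ W, (∀ z, v (g z) ≤ 1) ∧ v (g x - 1) < 1 ∧ v (g y) < 1 := by
  have hy' : v (f y) ≠ 0 := by simpa using hy
  -- Induction on the number of values of `v ∘ f` exceeding `v (f y)`. When there are none, `1 - f /
  -- f y` works; otherwise the largest one is removed.
  induction hn : {δ | v (f y) < δ ∧ ∃ z, v (f z) = δ}.ncard using Nat.strong_induction_on
    generalizing f with
  | _ n ih =>
  have hfin := (hW f hf).finite_values hy'
  rcases Set.eq_empty_or_nonempty {δ | v (f y) < δ ∧ ∃ z, v (f z) = δ} with hS | hS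
  · refine ⟨1 - (f y)⁻¹ • f, sub_mem (one_mem _) (W.smul_mem hf _), fun z => ?_, ?_, ?_⟩
    · refine (v.map_sub _ _).trans (max_le (by simp) ?_)
      have hz : v (f z) ≤ v (f y) := by
        by_contra! h
        exact Set.eq_empty_iff_forall_notMem.1 hS _ ⟨h, z, rfl⟩
      rw [Pi.smul_apply, smul_eq_mul, map_mul, map_inv₀, inv_mul_le_one₀ (zero_lt_iff.2 hy')]
      exact hz
    · simp [hx]
    · simp [hy]
  · obtain ⟨γ, ⟨hγ, t₀, ht₀⟩, hmax⟩ := hfin.exists_maximal hS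
    have hle : ∀ z, v (f z) ≤ γ := by
      intro z
      by_contra! h
      exact absurd (hmax ⟨hγ.trans h, z, rfl⟩ h.le) (not_le.2 h)
    have hγ0 : γ ≠ 0 := (zero_le.trans_lt hγ).ne'
    obtain ⟨T, hT⟩ := (hW f hf).exists_finset hγ0
    classical
    let T' := T.filter fun t => v (f t) = γ
    -- Every factor is congruent to 1 where `v ∘ f` is below its maximum `γ`. At a point where the
    -- maximum is attained, the factor of a nearby `t` has valuation less than 1.
    let e : X → L := ∏ t ∈ T', (1 - (f t)⁻¹ • f)
    have he : e ∈ W := prod_mem fun t _ => sub_mem (one_mem _) (W.smul_mem hf _)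
    have hez : ∀ z, e z = ∏ t ∈ T', (1 - (f t)⁻¹ * f z) := fun z => by simp [e]
    have hfac : ∀ z, ∀ t ∈ T', v (1 - (f t)⁻¹ * f z) ≤ 1 := by
      intro z t ht
      refine (v.map_sub _ _).trans (max_le (by simp) ?_)
      rw [map_mul, map_inv₀, (Finset.mem_filter.1 ht).2, inv_mul_le_one₀ (zero_lt_iff.2 hγ0)]
      exact hle z
    have hlow : ∀ z, v (f z) < γ → v (e z) = 1 := by
      intro z hz
      have : v (e z - 1) < 1 := by
        rw [hez]
        refine map_prod_sub_one_lt_one _ _ fun t ht => ?_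
        rw [sub_sub_cancel_left, v.map_neg, map_mul, map_inv₀, (Finset.mem_filter.1 ht).2,
          inv_mul_lt_one₀ (zero_lt_iff.2 hγ0)]
        exact hz
      simpa using v.map_eq_of_sub_lt (x := 1) (y := e z) (by simpa using this)
    have hhigh : ∀ z, v (f z) = γ → v (e z) < 1 := by
      intro z hz
      obtain ⟨t, htT, htz⟩ := hT z
      have hft : v (f t) = γ := by
        rw [← hz]
        refine v.map_eq_of_sub_lt ?_
        rwa [v.map_sub_swap, hz]
      rw [hez]
      refine map_prod_lt_one (hfac z) (Finset.mem_filter.2 ⟨htT, hft⟩) ?_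
      have hft0 : f t ≠ 0 := by rintro h; exact hγ0 (by rw [← hft, h, map_zero])
      have : 1 - (f t)⁻¹ * f z = (f t)⁻¹ * (f t - f z) := by field_simp
      rw [this, map_mul, map_inv₀, hft, inv_mul_lt_one₀ (zero_lt_iff.2 hγ0), v.map_sub_swap]
      exact htz
    -- Multiplying `f` by `e ^ N` pushes the top value below `v (f y)` and leaves the valuations at
    -- all other points unchanged.
    obtain ⟨N, hN⟩ := (hW e he).exists_pow_lt harch (γ := v (f y) / γ) (div_ne_zero hy' hγ0)
    have hv : ∀ z, v ((e ^ N * f) z) = v (e z) ^ N * v (f z) := fun z => by simp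
    have hlow' : ∀ z, v (f z) < γ → v ((e ^ N * f) z) = v (f z) := fun z hz => by
      rw [hv, hlow z hz, one_pow, one_mul]
    have hhigh' : ∀ z, v (f z) = γ → v ((e ^ N * f) z) < v (f y) := fun z hz => by
      rw [hv, hz, ← lt_div_iff₀ (zero_lt_iff.2 hγ0)]
      exact hN z (hhigh z hz)
    have hyv := hlow' y hγ
    refine ih _ ?_ (e ^ N * f) (mul_mem (pow_mem he N) hf) (by simp [hx])
      (by rw [← v.ne_zero_iff, hyv]; exact hy') (by rwa [hyv]) rfl
    rw [← hn]
    refine Set.ncard_lt_ncard ⟨?_, fun h => ?_⟩ hfin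
    · rintro _ ⟨hδ, z, rfl⟩
      rw [hyv] at hδ
      rcases (hle z).lt_or_eq with hz | hz
      · exact ⟨hδ, z, (hlow' z hz).symm⟩
      · exact absurd hδ (not_lt.2 (hhigh' z hz).le)
    · obtain ⟨hδ, z, hz⟩ := h ⟨hγ, t₀, ht₀⟩
      rcases (hle z).lt_or_eq with hz' | hz'
      · rw [hlow' z hz'] at hz
        exact hz'.ne hz
      · have := hhigh' z hz'
        rw [hz] at this
        exact lt_asymm this hγ

/-- **Kaplansky's nonarchimedean Stone–Weierstrass theorem**: a separating algebra of continuous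
functions approximates the indicator functions of the clopen sets. -/
theorem exists_approx_indicator (hsep : ∀ x y, x ≠ y → ∃ f ∈ W, f x ≠ f y) {C : Set X}
    (hC : IsClopen C) :
    ∃ f ∈ W, (∀ x ∈ C, v (f x - 1) < 1) ∧ ∀ x ∉ C, v (f x) < 1 := by
  have sub_lt : ∀ a b : L, v (a - b) < 1 → v a < 1 → v b < 1 := by
    intro a b hab ha
    have : b = a - (a - b) := by ring
    rw [this]
    exact v.map_sub_lt ha hab
  have sub_le : ∀ a : L, v a ≤ 1 → v (1 - a) ≤ 1 := fun a ha =>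
    (v.map_sub _ _).trans (max_le (by simp) ha)
  -- With `x` fixed, multiply separating functions over a finite cover of the complement of `C`.
  have hpoint : ∀ x ∈ C, ∃ g ∈ W, (∀ z, v (g z) ≤ 1) ∧ v (g x - 1) < 1 ∧ ∀ z ∈ Cᶜ, v (g z) < 1 := by
    intro x hx
    refine hC.compl.isClosed.isCompact.induction_on
      (p := fun s => ∃ g ∈ W, (∀ z, v (g z) ≤ 1) ∧ v (g x - 1) < 1 ∧ ∀ z ∈ s, v (g z) < 1)
      ⟨1, one_mem _, by simp, by simp, by simp⟩ ?_ ?_ ?_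
    · rintro s t hst ⟨g, hg, h1, h2, h3⟩
      exact ⟨g, hg, h1, h2, fun z hz => h3 z (hst hz)⟩
    · rintro s t ⟨g, hg, h1, h2, h3⟩ ⟨g', hg', h1', h2', h3'⟩
      refine ⟨g * g', mul_mem hg hg', fun z => ?_, map_mul_sub_one_lt_one h2 h2', ?_⟩
      · rw [Pi.mul_apply, map_mul]
        exact mul_le_one' (h1 z) (h1' z)
      · intro z hz
        rw [Pi.mul_apply, map_mul]
        rcases hz with hz | hz
        · exact mul_lt_one_of_lt_of_le (h3 z hz) (h1' z)
        · exact mul_comm (v (g z)) _ ▸ mul_lt_one_of_lt_of_le (h3' z hz) (h1 z)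
    · intro y hy
      obtain ⟨f, hf, hfxy⟩ := hsep x y (by rintro rfl; exact hy hx)
      obtain ⟨g, hg, h1, h2, h3⟩ := exists_separating_of_ne_zero harch W hW x y
        (f - f x • 1) (sub_mem hf (W.smul_mem (one_mem _) _)) (by simp)
        (by simpa [sub_eq_zero] using hfxy.symm)
      refine ⟨_, nhdsWithin_le_nhds (hW g hg 1 one_ne_zero y), g, hg, h1, h2, fun z hz => ?_⟩
      exact sub_lt _ _ (by rw [v.map_sub_swap]; exact hz) h3
  -- Multiply the functions `1 - g` for `g` from `hpoint` over a finite cover of `C`: the result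
  -- approximates the indicator of the complement.
  obtain ⟨g, hg, h1, h2, h3⟩ : ∃ g ∈ W, (∀ z, v (g z) ≤ 1) ∧ (∀ z ∈ C, v (g z) < 1) ∧
      ∀ z ∈ Cᶜ, v (g z - 1) < 1 := by
    refine hC.isClosed.isCompact.induction_on
      (p := fun s => ∃ g ∈ W, (∀ z, v (g z) ≤ 1) ∧ (∀ z ∈ s, v (g z) < 1) ∧
        ∀ z ∈ Cᶜ, v (g z - 1) < 1)
      ⟨1, one_mem _, by simp, by simp, by simp⟩ ?_ ?_ ?_
    · rintro s t hst ⟨g, hg, h1, h2, h3⟩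
      exact ⟨g, hg, h1, fun z hz => h2 z (hst hz), h3⟩
    · rintro s t ⟨g, hg, h1, h2, h3⟩ ⟨g', hg', h1', h2', h3'⟩
      refine ⟨g * g', mul_mem hg hg', fun z => ?_, fun z hz => ?_,
        fun z hz => map_mul_sub_one_lt_one (h3 z hz) (h3' z hz)⟩
      · rw [Pi.mul_apply, map_mul]
        exact mul_le_one' (h1 z) (h1' z)
      · rw [Pi.mul_apply, map_mul]
        rcases hz with hz | hz
        · exact mul_lt_one_of_lt_of_le (h2 z hz) (h1' z)
        · exact mul_comm (v (g z)) _ ▸ mul_lt_one_of_lt_of_le (h2' z hz) (h1 z)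
    · intro x hx
      obtain ⟨g, hg, h1, h2, h3⟩ := hpoint x hx
      refine ⟨_, nhdsWithin_le_nhds (hW g hg 1 one_ne_zero x), 1 - g, sub_mem (one_mem _) hg,
        fun z => sub_le _ (h1 z), fun z hz => ?_, fun z hz => by simpa using h3 z hz⟩
      rw [Pi.sub_apply, Pi.one_apply]
      refine sub_lt (1 - g x) _ ?_ (by rwa [v.map_sub_swap])
      rw [sub_sub_sub_cancel_left]
      exact hz
  refine ⟨1 - g, sub_mem (one_mem _) hg, fun x hx => by simpa using h2 x hx, fun x hx => ?_⟩
  rw [Pi.sub_apply, Pi.one_apply, v.map_sub_swap]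
  exact h3 x hx

end Kaplansky

end Valuation

/-! ### Projections and group elements of `E[[G]]`. -/

namespace Iwasawa

namespace IwasawaAlgebra

section Basic

variable (E : Type*) [Field E] {G : Type*} [CommGroup G] [TopologicalSpace G]

/-- The projection `E[[G]] → E[G/N]`. -/
noncomputable def proj (N : OpenSubgroup G) :
    IwasawaAlgebra E G →ₐ[E] MonoidAlgebra E (G ⧸ N.toSubgroup) :=
  (Pi.evalAlgHom E (fun N : OpenSubgroup G => MonoidAlgebra E (G ⧸ N.toSubgroup)) N).comp
    (IwasawaAlgebra E G).val

theorem transition_proj {N M : OpenSubgroup G} (h : N ≤ M) (x : IwasawaAlgebra E G) :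
    transition E G h (proj E N x) = proj E M x := x.2 N M h

theorem ext_proj {x y : IwasawaAlgebra E G} (h : ∀ N, proj E N x = proj E N y) : x = y :=
  Subtype.ext (funext h)

theorem transition_single {N M : OpenSubgroup G} (h : N ≤ M) (g : G) (c : E) :
    transition E G h (MonoidAlgebra.single (g : G ⧸ N.toSubgroup) c) =
      MonoidAlgebra.single (g : G ⧸ M.toSubgroup) c := by
  rw [transition, MonoidAlgebra.mapDomainAlgHom_apply, MonoidAlgebra.mapDomain_single]
  rfl

/-- The group element `g` in `E[[G]]`. -/
noncomputable def of : G →* IwasawaAlgebra E G where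
  toFun g := ⟨fun N => MonoidAlgebra.single (g : G ⧸ N.toSubgroup) 1,
    fun _ _ h => transition_single E h g 1⟩
  map_one' := rfl
  map_mul' g h := by
    ext1; funext N
    change MonoidAlgebra.single ((g * h : G) : G ⧸ N.toSubgroup) (1 : E) =
      MonoidAlgebra.single (g : G ⧸ N.toSubgroup) 1 * MonoidAlgebra.single (h : G ⧸ N.toSubgroup) 1
    rw [MonoidAlgebra.single_mul_single, one_mul, QuotientGroup.mk_mul]

theorem proj_of (N : OpenSubgroup G) (g : G) :
    proj E N (of E g) = MonoidAlgebra.single (g : G ⧸ N.toSubgroup) 1 := rfl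

/-- The canonical morphism `E[G] → E[[G]]`. -/
noncomputable def ofMonoidAlgebra : MonoidAlgebra E G →ₐ[E] IwasawaAlgebra E G :=
  MonoidAlgebra.lift E (IwasawaAlgebra E G) G (of E)

theorem proj_ofMonoidAlgebra (N : OpenSubgroup G) :
    (proj E N).comp (ofMonoidAlgebra E) =
      MonoidAlgebra.mapDomainAlgHom E E (QuotientGroup.mk' N.toSubgroup) := by
  ext g
  simp [ofMonoidAlgebra, proj_of]

theorem exists_proj_ofMonoidAlgebra_eq (N : OpenSubgroup G) (x : IwasawaAlgebra E G) :
    ∃ F, proj E N (ofMonoidAlgebra E F) = proj E N x := by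
  suffices h : Function.Surjective
      (MonoidAlgebra.mapDomainAlgHom E E (QuotientGroup.mk' N.toSubgroup)) by
    obtain ⟨F, hF⟩ := h (proj E N x)
    refine ⟨F, ?_⟩
    rw [← AlgHom.comp_apply, proj_ofMonoidAlgebra, hF]
  intro y
  induction y using MonoidAlgebra.induction_linear with
  | zero => exact ⟨0, map_zero _⟩
  | add x y hx hy =>
    obtain ⟨a, rfl⟩ := hx
    obtain ⟨b, rfl⟩ := hy
    exact ⟨a + b, map_add _ _ _⟩
  | single g r =>
    obtain ⟨g, rfl⟩ := QuotientGroup.mk_surjective g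
    exact ⟨MonoidAlgebra.single g r, by simp⟩

variable {E} in
theorem of_sub_of_mem_ker_proj {N : OpenSubgroup G} {g h : G} (hgh : g⁻¹ * h ∈ N) :
    proj E N (of E g - of E h) = 0 := by
  rw [map_sub, sub_eq_zero, proj_of, proj_of, QuotientGroup.eq.2 hgh]

variable {H : Type*} [CommGroup H] [TopologicalSpace H] (φ : G →ₜ* H)

theorem proj_map (N : OpenSubgroup H) (x : IwasawaAlgebra E G) :
    proj E N (map E φ x) = MonoidAlgebra.mapDomainAlgHom E E
      (QuotientGroup.map (N.comap φ.toMonoidHom φ.continuous_toFun).toSubgroup N.toSubgroup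
        φ.toMonoidHom (OpenSubgroup.toSubgroup_comap N _ _).le)
      (proj E (N.comap φ.toMonoidHom φ.continuous_toFun) x) := rfl

theorem map_of (g : G) : map E φ (of E g) = of E (φ g) := by
  refine ext_proj E fun N => ?_
  rw [proj_map, proj_of, proj_of, MonoidAlgebra.mapDomainAlgHom_apply,
    MonoidAlgebra.mapDomain_single]
  rfl

end Basic

section Invariant

open IsLocalRing Topology

variable {E : Type*} [Field E] {G : Type u} [CommGroup G] [TopologicalSpace G]

/-- A generator `s` of largest valuation dominates the whole maximal ideal, so the `k`-th power is
bounded by `v (φ s) ^ k`. This yields the continuity of `φ`. -/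
theorem _root_.IsLocalRing.exists_forall_mem_pow_valuation_lt {R : Type*} [CommRing R]
    [IsNoetherianRing R] [IsLocalRing R] {L : Type*} [Field L] (φ : R →+* L) {Γ₀ : Type*}
    [LinearOrderedCommGroupWithZero Γ₀] (v : Valuation L Γ₀) (hv : ∀ a, v (φ a) ≤ 1)
    (hvm : ∀ a ∈ maximalIdeal R, v (φ a) < 1)
    (harch : ∀ s γ, v s < 1 → γ ≠ 0 → ∃ k : ℕ, v s ^ k < γ) (γ : Γ₀) (hγ : γ ≠ 0) :
    ∃ k : ℕ, ∀ a ∈ maximalIdeal R ^ k, v (φ a) < γ := by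
  obtain ⟨S, hS⟩ := (isNoetherianRing_iff_ideal_fg R).1 inferInstance (maximalIdeal R)
  have hle : ∀ (J : Ideal R) (T : Set R) (δ : Γ₀), J = Ideal.span T → (∀ t ∈ T, v (φ t) ≤ δ) →
      ∀ a ∈ J, v (φ a) ≤ δ := by
    rintro J T δ rfl hT a ha
    induction ha using Submodule.span_induction with
    | mem x hx => exact hT x hx
    | zero => simp
    | add x y _ _ hx hy => rw [map_add]; exact (v.map_add _ _).trans (max_le hx hy)
    | smul r x _ hx =>
      rw [smul_eq_mul, map_mul, map_mul]
      exact (mul_le_of_le_one_left' (hv r)).trans hx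
  obtain ⟨s, hs, hms⟩ : ∃ s ∈ maximalIdeal R, ∀ a ∈ maximalIdeal R, v (φ a) ≤ v (φ s) := by
    classical
    have h0 : (insert 0 S).Nonempty := Finset.insert_nonempty _ _
    obtain ⟨s, hs, hmax⟩ := Finset.exists_max_image (insert 0 S) (fun a => v (φ a)) h0
    refine ⟨s, ?_, hle _ S _ hS.symm fun t ht => hmax t (Finset.mem_insert_of_mem ht)⟩
    rcases Finset.mem_insert.1 hs with rfl | hs
    · exact zero_mem _
    · rw [← hS]; exact Ideal.subset_span hs
  obtain ⟨k, hk⟩ := harch (φ s) γ (hvm s hs) hγ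
  refine ⟨k, fun a ha => lt_of_le_of_lt ?_ hk⟩
  clear hk
  induction k generalizing a with
  | zero => simpa using hv a
  | succ k ih =>
    rw [pow_succ] at ha
    refine Submodule.mul_induction_on ha (fun x hx y hy => ?_) fun x y hx hy => ?_
    · rw [map_mul, map_mul, pow_succ]
      exact mul_le_mul' (ih x hx) (hms y hy)
    · rw [map_add]
      exact (v.map_add _ _).trans (max_le hx hy)

end Invariant

end IwasawaAlgebra

end Iwasawa

/-! ### Elements of `E[[G]]` as measures, and stable ideals. -/

namespace Iwasawa

namespace IwasawaAlgebra

section Invariant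

open IsLocalRing Topology

section WeightedSum

variable {E : Type*} [Field E] {G : Type*}

/-- The sum of the values of `χ` against the measure with finite support `F`. -/
noncomputable def weightedSum {L : Type*} [Field L] (ι : E →+* L) (F : MonoidAlgebra E G)
    (χ : G → L) : L := F.coeff.sum fun g c => ι c * χ g

theorem weightedSum_add {L : Type*} [Field L] (ι : E →+* L) (F : MonoidAlgebra E G)
    (χ₁ χ₂ : G → L) :
    weightedSum ι F (χ₁ + χ₂) = weightedSum ι F χ₁ + weightedSum ι F χ₂ := by
  simp [weightedSum, mul_add, Finsupp.sum_add]

theorem weightedSum_sub {L : Type*} [Field L] (ι : E →+* L) (F : MonoidAlgebra E G)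
    (χ₁ χ₂ : G → L) :
    weightedSum ι F (χ₁ - χ₂) = weightedSum ι F χ₁ - weightedSum ι F χ₂ := by
  simp [weightedSum, mul_sub, Finsupp.sum_sub]

theorem weightedSum_smul {L : Type*} [Field L] (ι : E →+* L) (F : MonoidAlgebra E G) (l : L)
    (χ : G → L) : weightedSum ι F (l • χ) = l * weightedSum ι F χ := by
  simp only [weightedSum, Pi.smul_apply, smul_eq_mul, Finsupp.mul_sum]
  exact Finsupp.sum_congr fun g _ => by ring

theorem valuation_weightedSum_lt {L : Type*} [Field L] {ι : E →+* L} {Γ₀ : Type*}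
    [LinearOrderedCommGroupWithZero Γ₀] {v : Valuation L Γ₀} (hι : ∀ c, v (ι c) ≤ 1)
    (F : MonoidAlgebra E G) {χ : G → L} {γ : Γ₀} (hγ : γ ≠ 0) (hχ : ∀ g, v (χ g) < γ) :
    v (weightedSum ι F χ) < γ := by
  refine v.map_sum_lt hγ fun g _ => ?_
  rw [map_mul]
  exact (mul_le_of_le_one_left' (hι _)).trans_lt (hχ g)

theorem _root_.Valuation.map_eq_one_of_forall_le_one {L : Type*} [Field L] {ι : E →+* L}
    {Γ₀ : Type*} [LinearOrderedCommGroupWithZero Γ₀] {v : Valuation L Γ₀}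
    (hι : ∀ c, v (ι c) ≤ 1) {c : E} (hc : c ≠ 0) : v (ι c) = 1 := by
  refine le_antisymm (hι c) ?_
  have h := hι c⁻¹
  rwa [map_inv₀, map_inv₀, inv_le_one₀] at h
  exact zero_lt_iff.2 (by simpa using hc)

end WeightedSum

variable {E : Type*} [Field E] {G : Type*} [CommGroup G] [TopologicalSpace G]

theorem map_ofMonoidAlgebra {L : Type*} [Field L] (φ : IwasawaAlgebra E G →+* L)
    (F : MonoidAlgebra E G) :
    φ (ofMonoidAlgebra E F) =
      weightedSum (φ.comp (algebraMap E (IwasawaAlgebra E G))) F fun g => φ (of E g) := by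
  rw [ofMonoidAlgebra, MonoidAlgebra.lift_apply, Finsupp.sum, map_sum]
  refine Finset.sum_congr rfl fun g _ => ?_
  rw [Algebra.smul_def, map_mul]
  rfl

open Classical in
theorem coeff_proj_ofMonoidAlgebra {L : Type*} [Field L] (ι : E →+* L) (N : OpenSubgroup G)
    (F : MonoidAlgebra E G) (q : G ⧸ N.toSubgroup) :
    ι ((proj E N (ofMonoidAlgebra E F)).coeff q) =
      weightedSum ι F (Set.indicator {g : G | (g : G ⧸ N.toSubgroup) = q} 1) := by
  rw [← AlgHom.comp_apply, proj_ofMonoidAlgebra, MonoidAlgebra.mapDomainAlgHom_apply]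
  simp only [MonoidAlgebra.mapDomain, Finsupp.mapDomain, Finsupp.sum_apply, weightedSum]
  rw [Finsupp.sum, map_sum]
  refine Finset.sum_congr rfl fun g _ => ?_
  simp [Finsupp.single_apply, Set.indicator_apply, apply_ite ι]

theorem continuousMod_of [IsTopologicalGroup G] {L : Type*} [Field L] {φ : IwasawaAlgebra E G →+* L} {Γ₀ : Type*}
    [LinearOrderedCommGroupWithZero Γ₀] {v : Valuation L Γ₀}
    (hsmall : ∀ γ : Γ₀, γ ≠ 0 → ∃ N : OpenSubgroup G, ∀ x, proj E N x = 0 → v (φ x) < γ) :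
    v.ContinuousMod fun g => φ (of E g) := by
  intro γ hγ g
  obtain ⟨N, hN⟩ := hsmall γ hγ
  have h1 : {h : G | h⁻¹ * g ∈ N} ∈ 𝓝 g := by
    have hc : Continuous fun h : G => h⁻¹ * g := continuous_inv.mul continuous_const
    refine hc.continuousAt.preimage_mem_nhds ?_
    rw [inv_mul_cancel]
    exact N.mem_nhds_one
  filter_upwards [h1] with h hh
  rw [← map_sub]
  exact hN _ (of_sub_of_mem_ker_proj hh)

/-- If the character were trivial, `φ a` would be arbitrarily close to constants from `E`. These
have valuation 0 or 1, whereas `φ a` is nonzero of valuation less than 1. -/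
theorem exists_map_of_ne_one {L : Type*} [Field L] {φ : IwasawaAlgebra E G →+* L} {Γ₀ : Type*}
    [LinearOrderedCommGroupWithZero Γ₀] {v : Valuation L Γ₀} (hv : ∀ a, v (φ a) ≤ 1)
    (hsmall : ∀ γ : Γ₀, γ ≠ 0 → ∃ N : OpenSubgroup G, ∀ x, proj E N x = 0 → v (φ x) < γ)
    {a : IwasawaAlgebra E G} (ha : v (φ a) < 1) (ha0 : φ a ≠ 0) : ∃ g, φ (of E g) ≠ 1 := by
  by_contra! hone
  obtain ⟨N, hN⟩ := hsmall (v (φ a)) (by simpa using ha0)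
  obtain ⟨F, hF⟩ := exists_proj_ofMonoidAlgebra_eq E N a
  have h1 := hN (ofMonoidAlgebra E F - a) (by rw [map_sub, hF, sub_self])
  have h2 : φ (ofMonoidAlgebra E F) =
      φ (algebraMap E _ (F.coeff.sum fun _ c => c)) := by
    rw [map_ofMonoidAlgebra, weightedSum, Finsupp.sum, Finsupp.sum, map_sum, map_sum]
    simp [hone]
  rw [map_sub, h2] at h1
  by_cases h0 : (F.coeff.sum fun _ c => c) = 0
  · rw [h0, map_zero, map_zero, zero_sub, v.map_neg] at h1
    exact lt_irrefl _ h1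
  · have h3 := v.map_eq_of_sub_lt h1
    exact ha.ne (h3.symm.trans (Valuation.map_eq_one_of_forall_le_one
      (ι := φ.comp (algebraMap E (IwasawaAlgebra E G))) (fun c => hv _) h0))

/-- This is the vanishing of `∫ χ w df` for `w` in the span of the functions `X y`. Since
`weightedSum` needs finite support, `f` is replaced by an approximation `F`, and vanishing becomes
smallness. For a single `X y` the integral is `φ (map E (Φ y) f) = 0`. -/
theorem valuation_weightedSum_lift_lt {L : Type*} [Field L] {φ : IwasawaAlgebra E G →+* L}
    {Γ₀ : Type*} [LinearOrderedCommGroupWithZero Γ₀] {v : Valuation L Γ₀}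
    (hsmall : ∀ γ : Γ₀, γ ≠ 0 → ∃ N : OpenSubgroup G, ∀ x, proj E N x = 0 → v (φ x) < γ)
    {Y : Type*} [AddCommMonoid Y] (Φ : Y → G →ₜ* G) (X : Multiplicative Y →* G → L)
    (hX : ∀ y g, φ (of E (Φ y g)) = φ (of E g) * X (Multiplicative.ofAdd y) g)
    {f : IwasawaAlgebra E G} (hf : ∀ y, φ (map E (Φ y) f) = 0)
    (w : MonoidAlgebra L (Multiplicative Y)) :
    ∀ γ : Γ₀, γ ≠ 0 → ∃ N : OpenSubgroup G, ∀ F, proj E N (ofMonoidAlgebra E F) = proj E N f →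
      v (weightedSum (φ.comp (algebraMap E (IwasawaAlgebra E G))) F fun g =>
        φ (of E g) * MonoidAlgebra.lift L (G → L) (Multiplicative Y) X w g) < γ := by
  induction w using MonoidAlgebra.induction_linear with
  | zero =>
    refine fun γ hγ => ⟨⊤, fun F _ => ?_⟩
    simpa [weightedSum] using zero_lt_iff.2 hγ
  | add w₁ w₂ h₁ h₂ =>
    intro γ hγ
    obtain ⟨N₁, hN₁⟩ := h₁ γ hγ
    obtain ⟨N₂, hN₂⟩ := h₂ γ hγ
    refine ⟨N₁ ⊓ N₂, fun F hF => ?_⟩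
    have e : (fun g => φ (of E g) *
        MonoidAlgebra.lift L (G → L) (Multiplicative Y) X (w₁ + w₂) g) =
        (fun g => φ (of E g) * MonoidAlgebra.lift L (G → L) (Multiplicative Y) X w₁ g) +
        fun g => φ (of E g) * MonoidAlgebra.lift L (G → L) (Multiplicative Y) X w₂ g := by
      funext g
      simp only [map_add, Pi.add_apply, mul_add]
    rw [e, weightedSum_add]
    refine v.map_add_lt (hN₁ F ?_) (hN₂ F ?_)
    · rw [← transition_proj E (inf_le_left : N₁ ⊓ N₂ ≤ N₁), hF, transition_proj]
    · rw [← transition_proj E (inf_le_right : N₁ ⊓ N₂ ≤ N₂), hF, transition_proj]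
  | single y l =>
    intro γ hγ
    by_cases hl : l = 0
    · refine ⟨⊤, fun F _ => ?_⟩
      simpa [weightedSum, hl] using zero_lt_iff.2 hγ
    have hvl : v l ≠ 0 := by simpa using hl
    obtain ⟨M, hM⟩ := hsmall (γ / v l) (div_ne_zero hγ hvl)
    refine ⟨M.comap (Φ y.toAdd).toMonoidHom (Φ y.toAdd).continuous_toFun, fun F hF => ?_⟩
    have h1 := hM (map E (Φ y.toAdd) (ofMonoidAlgebra E F - f)) (by
      rw [proj_map, map_sub, hF, sub_self, map_zero])
    rw [map_sub, map_sub, hf, sub_zero] at h1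
    have e : (fun g => φ (of E g) *
        MonoidAlgebra.lift L (G → L) (Multiplicative Y) X (MonoidAlgebra.single y l) g) =
        l • fun g => (φ.comp (map E (Φ y.toAdd) : IwasawaAlgebra E G →+* _)) (of E g) := by
      funext g
      rw [MonoidAlgebra.lift_single, Pi.smul_apply, Pi.smul_apply, RingHom.comp_apply,
        RingHom.coe_coe, map_of, hX, smul_eq_mul, smul_eq_mul]
      change _ * (l * X y g) = l * (_ * X y g)
      ring
    have e2 := map_ofMonoidAlgebra (φ.comp (map E (Φ y.toAdd) : IwasawaAlgebra E G →+* _)) F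
    have e3 : (φ.comp (map E (Φ y.toAdd) : IwasawaAlgebra E G →+* _)).comp
        (algebraMap E (IwasawaAlgebra E G)) = φ.comp (algebraMap E (IwasawaAlgebra E G)) := by
      ext c
      simp
    rw [e3] at e2
    rw [e, weightedSum_smul, ← e2, map_mul, mul_comm, ← lt_div_iff₀ (zero_lt_iff.2 hvl)]
    exact h1

/-- Let `Φ` be a family of endomorphisms `g ↦ g * ψ y g` of `G`, with `ψ` additive in `y` and rich
enough that `y ↦ ψ y g` takes all `p ^ s`-th powers as values for `g ≠ 1`. A nonzero ideal stable
under this family contains a power of the maximal ideal. -/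
theorem exists_maximalIdeal_pow_le [CompactSpace G] [IsTopologicalGroup G]
    [IsNoetherianRing (IwasawaAlgebra E G)] [IsLocalRing (IwasawaAlgebra E G)]
    (p : ℕ) [Fact p.Prime] [CharP E p]
    (hof : ∀ g, of E g - 1 ∈ maximalIdeal (IwasawaAlgebra E G))
    (hker : ∀ k, ∃ N : OpenSubgroup G, ∀ x, proj E N x = 0 →
      x ∈ maximalIdeal (IwasawaAlgebra E G) ^ k)
    {Y : Type*} [AddCommMonoid Y] (ψ Φ : Y → G →ₜ* G) (hψ0 : ∀ g, ψ 0 g = 1)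
    (hψ : ∀ y z g, ψ (y + z) g = ψ y g * ψ z g) (hΦ : ∀ y g, Φ y g = g * ψ y g)
    (hrich : ∀ g ≠ 1, ∃ s : ℕ, ∀ h, ∃ y, ψ y g = h ^ p ^ s)
    (I : Ideal (IwasawaAlgebra E G)) (hI : ∀ y, ∀ x ∈ I, map E (Φ y) x ∈ I) (hI0 : I ≠ ⊥) :
    ∃ k, maximalIdeal (IwasawaAlgebra E G) ^ k ≤ I := by
  -- The maximal ideal being finitely generated, it suffices that every prime containing `I` is
  -- maximal.
  refine Ideal.exists_pow_le_of_le_radical_of_fg ?_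
    ((isNoetherianRing_iff_ideal_fg _).1 inferInstance _)
  rw [Ideal.radical_eq_sInf, le_sInf_iff]
  rintro Q ⟨hIQ, hQ⟩
  by_contra hQm
  replace hQm : Q ≠ maximalIdeal (IwasawaAlgebra E G) := fun h => hQm h.ge
  obtain ⟨L, _, φ, Γ₀, _, v, hφQ, ⟨a, ham, ha0⟩, hv, hvm, harch⟩ :=
    exists_archimedean_valuation Q hQm
  let ι := φ.comp (algebraMap E (IwasawaAlgebra E G))
  have hι : ∀ c, v (ι c) ≤ 1 := fun c => hv _
  have : CharP L p := charP_of_injective_ringHom ι.injective p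
  have hsmall : ∀ γ : Γ₀, γ ≠ 0 → ∃ N : OpenSubgroup G, ∀ x, proj E N x = 0 → v (φ x) < γ := by
    intro γ hγ
    obtain ⟨k, hk⟩ := exists_forall_mem_pow_valuation_lt φ v hv hvm harch γ hγ
    obtain ⟨N, hN⟩ := hker k
    exact ⟨N, fun x hx => hk x (hN x hx)⟩
  have hχ1 : ∀ g, v (φ (of E g) - 1) < 1 := fun g => by
    simpa using hvm _ (hof g)
  obtain ⟨u, hu⟩ := exists_map_of_ne_one hv hsmall (hvm a ham) ha0
  have hχcont : v.ContinuousMod fun g => φ (of E g) := continuousMod_of hsmall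
  let X : Multiplicative Y →* G → L :=
    { toFun := fun y g => φ (of E (ψ y.toAdd g))
      map_one' := by funext g; simp [hψ0]
      map_mul' := fun y z => by funext g; simp [hψ] }
  -- Since `X` is multiplicative in `y`, its linear span is the range of an algebra morphism.
  let W : Subalgebra L (G → L) := (MonoidAlgebra.lift L (G → L) (Multiplicative Y) X).range
  have hW : ∀ f ∈ W, v.ContinuousMod f := by
    rintro _ ⟨w, rfl⟩
    induction w using MonoidAlgebra.induction_linear with
    | zero =>
      intro γ hγ g
      simpa using zero_lt_iff.2 hγ
    | add w₁ w₂ h₁ h₂ =>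
      intro γ hγ g
      filter_upwards [h₁ γ hγ g, h₂ γ hγ g] with h hh₁ hh₂
      rw [map_add, Pi.add_apply, Pi.add_apply, add_sub_add_comm]
      exact v.map_add_lt hh₁ hh₂
    | single y l =>
      intro γ hγ g
      by_cases hl : l = 0
      · simpa [hl] using zero_lt_iff.2 hγ
      have hvl : v l ≠ 0 := by simpa using hl
      have h1 := ((ψ y.toAdd).continuous_toFun.tendsto g).eventually
        (hχcont (γ / v l) (div_ne_zero hγ hvl) (ψ y.toAdd g))
      filter_upwards [h1] with h hh
      change v (φ (of E (ψ y.toAdd h)) - φ (of E (ψ y.toAdd g))) < _ at hh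
      rw [lt_div_iff₀ (zero_lt_iff.2 hvl), mul_comm, ← map_mul, mul_sub] at hh
      simpa [MonoidAlgebra.lift_single, X] using hh
  have hsep : ∀ g h, g ≠ h → ∃ f ∈ W, f g ≠ f h := by
    intro g h hgh
    obtain ⟨s, hs⟩ := hrich (g⁻¹ * h) (by rwa [Ne, inv_mul_eq_one])
    obtain ⟨y, hy⟩ := hs u
    refine ⟨X (Multiplicative.ofAdd y), ⟨MonoidAlgebra.single (Multiplicative.ofAdd y) 1, by simp⟩,
      fun heq => hu ?_⟩
    change φ (of E (ψ y g)) = φ (of E (ψ y h)) at heq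
    have h1 : φ (of E (ψ y h)) = φ (of E (ψ y g)) * φ (of E u) ^ p ^ s := by
      rw [← map_pow, ← map_pow, ← hy, ← map_mul, ← map_mul, ← map_mul, mul_inv_cancel_left]
    have h2 : φ (of E (ψ y g)) ≠ 0 := fun h0 => by
      have := hχ1 (ψ y g)
      simp [h0] at this
    have h3 : φ (of E u) ^ p ^ s = 1 := by
      rw [← heq] at h1
      exact (mul_eq_left₀ h2).1 h1.symm
    -- In characteristic `p`, `χ(u) ^ p ^ s - 1 = (χ(u) - 1) ^ p ^ s`, so `χ(u)` would be 1.
    rw [← sub_eq_zero, ← pow_eq_zero_iff (pow_ne_zero s (Fact.out : p.Prime).ne_zero),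
      sub_pow_char_pow, h3, one_pow, sub_self]
  obtain ⟨f, hfI, hf0⟩ := Submodule.exists_mem_ne_zero_of_ne_bot hI0
  obtain ⟨N₀, hN₀⟩ : ∃ N, proj E N f ≠ 0 := by
    by_contra! h
    exact hf0 (ext_proj E fun N => by rw [h N, map_zero])
  obtain ⟨q, hq⟩ : ∃ q, (proj E N₀ f).coeff q ≠ 0 := by
    by_contra! h
    exact hN₀ (MonoidAlgebra.ext (Finsupp.ext h))
  let C : Set G := {g : G | (g : G ⧸ N₀.toSubgroup) = q}
  have hC : IsClopen C := by
    obtain ⟨a, rfl⟩ := QuotientGroup.mk_surjective q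
    have : C = (fun g => a⁻¹ * g) ⁻¹' (N₀ : Set G) := by
      ext g
      exact eq_comm.trans QuotientGroup.eq
    rw [this]
    exact N₀.isClopen.preimage (continuous_const.mul continuous_id)
  obtain ⟨_, ⟨w, rfl⟩, hΨ1, hΨ2⟩ := Valuation.exists_approx_indicator harch W hW hsep hC
  obtain ⟨N, hN⟩ := valuation_weightedSum_lift_lt hsmall Φ X
    (fun y g => by
      rw [hΦ, map_mul, map_mul]
      rfl) (f := f) (fun y => hφQ _ (hIQ (hI y f hfI))) w 1 one_ne_zero
  -- `F` must agree with `f` at level `N`, for the integral to be small, and at level `N₀`, to have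
  -- the same coefficient at `q`.
  obtain ⟨F, hF⟩ := exists_proj_ofMonoidAlgebra_eq E (N ⊓ N₀) f
  have h1 := hN F (by rw [← transition_proj E (inf_le_left : N ⊓ N₀ ≤ N), hF, transition_proj])
  have h2 := coeff_proj_ofMonoidAlgebra ι N₀ F q
  rw [← transition_proj E (inf_le_right : N ⊓ N₀ ≤ N₀), hF, transition_proj] at h2
  -- Both `χ` is congruent to 1 and `w` to the indicator of `C`, so the two integrands agree modulo
  -- the maximal ideal of the valuation.
  have h3 : v (weightedSum ι F (fun g => φ (of E g) *
      MonoidAlgebra.lift L (G → L) (Multiplicative Y) X w g) -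
        weightedSum ι F (Set.indicator C 1)) < 1 := by
    rw [← weightedSum_sub]
    refine valuation_weightedSum_lt hι F one_ne_zero fun g => ?_
    rw [Pi.sub_apply]
    by_cases hg : g ∈ C
    · rw [Set.indicator_of_mem hg]
      exact Valuation.map_mul_sub_one_lt_one (hχ1 g) (hΨ1 g hg)
    · rw [Set.indicator_of_notMem hg, sub_zero, map_mul]
      exact mul_comm (v (φ (of E g))) _ ▸ mul_lt_one_of_lt_of_le (hΨ2 g hg) (hv _)
  rw [← h2] at h3
  have h4 := Valuation.map_eq_one_of_forall_le_one hι hq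
  have h5 := v.map_sub_lt h1 h3
  rw [sub_sub_cancel, h4] at h5
  exact lt_irrefl _ h5

end Invariant

end IwasawaAlgebra

end Iwasawa

/-! ### Maximal ideal and dimension of power series rings. -/

namespace MvPowerSeries

open Finsupp IsLocalRing

variable {d : ℕ} {E : Type*} [Field E]

/-- Assign each monomial of `F` to the first variable dividing it. The control on the coefficients
of `G i` lets vanishing in low degrees pass to them in `mem_span_X_pow`. -/
theorem exists_eq_sum_X_mul {F : MvPowerSeries (Fin d) E} (hF : coeff 0 F = 0) :
    ∃ G : Fin d → MvPowerSeries (Fin d) E, F = ∑ i, X i * G i ∧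
      ∀ i s, coeff s (G i) = 0 ∨ coeff s (G i) = coeff (s + single i 1) F := by
  classical
  let G : Fin d → MvPowerSeries (Fin d) E := fun i s =>
    if ∀ j < i, s j = 0 then coeff (s + single i 1) F else 0
  have hG : ∀ i s, coeff s (G i) = if ∀ j < i, s j = 0 then coeff (s + single i 1) F else 0 :=
    fun i s => rfl
  refine ⟨G, ?_, fun i s => ?_⟩
  · ext t
    simp only [map_sum, X_def, coeff_monomial_mul, one_mul, hG]
    by_cases ht : t = 0
    · subst ht
      rw [hF, Finset.sum_eq_zero]
      intro i _
      rw [if_neg]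
      intro h
      simpa using h i
    have hne : t.support.Nonempty := by simpa using ht
    set i := t.support.min' hne with hi
    have hti : t i ≠ 0 := Finsupp.mem_support_iff.1 (Finset.min'_mem _ hne)
    have hlt : ∀ j < i, t j = 0 := by
      intro j hj
      by_contra h
      exact absurd (Finset.min'_le _ j (Finsupp.mem_support_iff.2 h)) (not_le.2 hj)
    have hle : single i 1 ≤ t := by
      rw [Finsupp.single_le_iff]
      exact Nat.one_le_iff_ne_zero.2 hti
    rw [Finset.sum_eq_single i]
    · rw [if_pos hle, if_pos, tsub_add_cancel_of_le hle]
      intro j hj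
      simp [hlt j hj]
    · intro j _ hji
      split_ifs with h1 h2
      · rw [Finsupp.single_le_iff] at h1
        rcases lt_or_gt_of_ne hji with h | h
        · rw [hlt j h] at h1
          exact absurd h1 (by simp)
        · have := h2 i h
          simp [hji] at this
          exact absurd this hti
      · rfl
      · rfl
    · simp
  · rw [hG]
    split_ifs
    · exact Or.inr rfl
    · exact Or.inl rfl

theorem mem_span_X_pow {k : ℕ} {F : MvPowerSeries (Fin d) E}
    (hF : ∀ s : Fin d →₀ ℕ, degree s < k → coeff s F = 0) :
    F ∈ Ideal.span (Set.range (X : Fin d → MvPowerSeries (Fin d) E)) ^ k := by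
  induction k generalizing F with
  | zero => simp
  | succ k ih =>
    obtain ⟨G, rfl, hG⟩ := exists_eq_sum_X_mul (hF 0 (by simp))
    rw [pow_succ']
    refine Ideal.sum_mem _ fun i _ =>
      Ideal.mul_mem_mul (Ideal.subset_span ⟨i, rfl⟩) (ih fun s hs => ?_)
    rcases hG i s with h | h
    · exact h
    · rw [h, hF]
      simpa using hs

theorem maximalIdeal_eq_span_X :
    maximalIdeal (MvPowerSeries (Fin d) E) = Ideal.span (Set.range X) := by
  refine le_antisymm (fun F hF => ?_) (Ideal.span_le.2 ?_)
  · rw [← pow_one (Ideal.span _)]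
    refine mem_span_X_pow fun s hs => ?_
    rw [Nat.lt_one_iff, Finsupp.degree_eq_zero_iff] at hs
    subst hs
    by_contra h
    refine (mem_maximalIdeal _).1 hF ?_
    rw [isUnit_iff_constantCoeff]
    exact (isUnit_iff_ne_zero).2 h
  · rintro _ ⟨i, rfl⟩
    refine (mem_maximalIdeal _).2 fun h => ?_
    rw [isUnit_iff_constantCoeff] at h
    simp at h

/-- The upper bound counts the generators of the maximal ideal; the lower bound adjoins one variable
at a time. -/
theorem ringKrullDim_fin : ringKrullDim (MvPowerSeries (Fin d) E) = d := by
  refine le_antisymm ?_ ?_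
  · refine (ringKrullDim_le_spanFinrank_maximalIdeal _).trans ?_
    rw [maximalIdeal_eq_span_X]
    refine Nat.cast_le.2 ((Submodule.spanFinrank_span_le_ncard_of_finite
      (Set.finite_range _)).trans ?_)
    rw [← Nat.card_coe_set_eq]
    exact (Finite.card_range_le _).trans (by simp)
  · induction d with
    | zero => simpa using ringKrullDim_nonneg_of_nontrivial
    | succ n ih =>
      rw [ringKrullDim_eq_of_ringEquiv (finSuccEquiv E n).toRingEquiv]
      push_cast
      exact (by gcongr : (n : WithBot ℕ∞) + 1 ≤ _).trans
        ringKrullDim_succ_le_ringKrullDim_powerseries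

end MvPowerSeries

/-! ### `E[[G]]` as a power series ring. -/

namespace Iwasawa

open Finsupp IsLocalRing

section PadicBasis

/-- The subgroups `N n` form a basis of neighborhoods of `1` in `G` and the elements `g i` behave
like a `ℤ_p`-basis of `G` such that `N n = G ^ (p ^ n)`. -/
structure IsPadicBasis (p : ℕ) {G : Type*} [CommGroup G] [TopologicalSpace G] {d : ℕ}
    (g : Fin d → G) (N : ℕ → OpenSubgroup G) : Prop where
  pow_mem : ∀ n i, g i ^ p ^ n ∈ N n
  exists_prod : ∀ n h, ∃ k : Fin d → ℕ, (∏ i, g i ^ k i)⁻¹ * h ∈ N n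
  card : ∀ n, Nat.card (G ⧸ (N n).toSubgroup) = p ^ (d * n)
  anti : Antitone N
  exists_le : ∀ M : OpenSubgroup G, ∃ n, N n ≤ M

variable {p : ℕ} [Fact p.Prime] {E : Type*} [Field E] [CharP E p]
  {G : Type*} [CommGroup G] [TopologicalSpace G] {d : ℕ}

variable (E) in
/-- The evaluation of polynomials at the elements `g i - 1` of `E[G/N]`. -/
noncomputable def evalPoly (g : Fin d → G) (N : OpenSubgroup G) :
    MvPolynomial (Fin d) E →ₐ[E] MonoidAlgebra E (G ⧸ N.toSubgroup) :=
  MvPolynomial.aeval fun i => IwasawaAlgebra.proj E N (IwasawaAlgebra.of E (g i) - 1)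

theorem transition_evalPoly (g : Fin d → G) {N M : OpenSubgroup G} (h : N ≤ M)
    (P : MvPolynomial (Fin d) E) : transition E G h (evalPoly E g N P) = evalPoly E g M P := by
  have : (transition E G h).comp (evalPoly E g N) = evalPoly E g M := by
    ext i
    simp [evalPoly, ← IwasawaAlgebra.transition_proj E h]
  exact DFunLike.congr_fun this P

namespace IsPadicBasis

variable {g : Fin d → G} {N : ℕ → OpenSubgroup G} (hgN : IsPadicBasis p g N)

include hgN

/-- By Frobenius, `(g i - 1) ^ p ^ n = g i ^ p ^ n - 1`, and `g i ^ p ^ n` is trivial modulo `N n`.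
-/
theorem proj_pow_eq_zero (n : ℕ) (i : Fin d) {k : ℕ} (hk : p ^ n ≤ k) :
    IwasawaAlgebra.proj E (N n) (IwasawaAlgebra.of E (g i) - 1) ^ k = 0 := by
  have : CharP (MonoidAlgebra E (G ⧸ (N n).toSubgroup)) p :=
    charP_of_injective_algebraMap (algebraMap E _).injective p
  refine pow_eq_zero_of_le hk ?_
  rw [map_sub, map_one, sub_pow_char_pow, one_pow, ← map_pow, ← map_pow, sub_eq_zero,
    ← map_one (IwasawaAlgebra.proj E (N n)), ← map_one (IwasawaAlgebra.of E), ← sub_eq_zero,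
    ← map_sub]
  exact IwasawaAlgebra.of_sub_of_mem_ker_proj (by
    rw [mul_one]; exact inv_mem (hgN.pow_mem n i))

/-- The images of the monomials with exponents less than `p ^ n` in `E[G/N n]`. -/
noncomputable def monomialFamily (_ : IsPadicBasis p g N) (E : Type*) [Field E] (n : ℕ)
    (α : Fin d → Fin (p ^ n)) : MonoidAlgebra E (G ⧸ (N n).toSubgroup) :=
  ∏ i, IwasawaAlgebra.proj E (N n) (IwasawaAlgebra.of E (g i) - 1) ^ (α i : ℕ)

omit hgN in
/-- A tuple of exponents as a finitely supported function. -/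
noncomputable def exponent {d m : ℕ} (α : Fin d → Fin m) : Fin d →₀ ℕ :=
  Finsupp.equivFunOnFinite.symm fun i => (α i : ℕ)

theorem evalPoly_eq_sum (n : ℕ) (P : MvPolynomial (Fin d) E) :
    evalPoly E g (N n) P = ∑ α, P.coeff (exponent α) • hgN.monomialFamily E n α := by
  classical
  induction P using MvPolynomial.induction_on' with
  | add P Q hP hQ => simp only [map_add, hP, hQ, MvPolynomial.coeff_add, add_smul,
      Finset.sum_add_distrib]
  | monomial s a =>
    simp only [evalPoly, MvPolynomial.aeval_monomial, MvPolynomial.coeff_monomial, ite_smul,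
      zero_smul]
    rw [Finsupp.prod_fintype _ _ fun i => pow_zero _, ← Algebra.smul_def]
    by_cases hs : ∀ i, s i < p ^ n
    · rw [Finset.sum_eq_single (fun i => ⟨s i, hs i⟩)]
      · rw [if_pos (by ext i; rfl)]
        rfl
      · intro α _ hα
        rw [if_neg]
        rintro rfl
        exact hα rfl
      · simp
    · push Not at hs
      obtain ⟨i, hi⟩ := hs
      rw [Finset.prod_eq_zero (Finset.mem_univ i) (hgN.proj_pow_eq_zero n i hi), smul_zero,
        Finset.sum_eq_zero]
      intro α _
      rw [if_neg]
      rintro rfl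
      exact absurd hi (not_le.2 (α i).2)

omit [Fact p.Prime] [CharP E p] in
theorem evalPoly_surjective (n : ℕ) : Function.Surjective (evalPoly E g (N n)) := by
  have h1 : ∀ i, IwasawaAlgebra.proj E (N n) (IwasawaAlgebra.of E (g i)) ∈
      (evalPoly E g (N n)).range := fun i => ⟨1 + MvPolynomial.X i, by simp [evalPoly]⟩
  rw [← AlgHom.range_eq_top, eq_top_iff]
  rintro x -
  induction x using MonoidAlgebra.induction_linear with
  | zero => exact zero_mem _
  | add x y hx hy => exact add_mem hx hy
  | single h r =>
    obtain ⟨h, rfl⟩ := QuotientGroup.mk_surjective h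
    obtain ⟨k, hk⟩ := hgN.exists_prod n h
    have h2 : MonoidAlgebra.single (h : G ⧸ (N n).toSubgroup) r =
        r • IwasawaAlgebra.proj E (N n) (IwasawaAlgebra.of E (∏ i, g i ^ k i)) := by
      rw [IwasawaAlgebra.proj_of, QuotientGroup.eq.2 hk, MonoidAlgebra.smul_single, smul_eq_mul,
        mul_one]
    rw [h2, map_prod, map_prod]
    refine Subalgebra.smul_mem _ (Subalgebra.prod_mem _ fun i _ => ?_) _
    rw [map_pow, map_pow]
    exact Subalgebra.pow_mem _ (h1 i) _

/-- The monomials span, and there are `p ^ (d * n)` of them, which is the dimension of `E[G/N n]`.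
-/
theorem linearIndependent_monomialFamily (n : ℕ) :
    LinearIndependent E (hgN.monomialFamily E n) := by
  refine linearIndependent_of_top_le_span_of_card_eq_finrank ?_ ?_
  · rintro x -
    obtain ⟨P, rfl⟩ := hgN.evalPoly_surjective n x
    rw [hgN.evalPoly_eq_sum]
    exact Submodule.sum_mem _ fun α _ =>
      Submodule.smul_mem _ _ (Submodule.subset_span ⟨α, rfl⟩)
  · rw [Module.finrank_eq_nat_card_basis (MonoidAlgebra.basis (G ⧸ (N n).toSubgroup) E),
      hgN.card, Fintype.card_fun, Fintype.card_fin, Fintype.card_fin, ← pow_mul, mul_comm]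

theorem evalPoly_eq_zero_iff (n : ℕ) (P : MvPolynomial (Fin d) E) :
    evalPoly E g (N n) P = 0 ↔ ∀ s : Fin d →₀ ℕ, (∀ i, s i < p ^ n) → P.coeff s = 0 := by
  rw [hgN.evalPoly_eq_sum]
  constructor
  · intro h s hs
    have := Fintype.linearIndependent_iff.1 (hgN.linearIndependent_monomialFamily n) _ h
      fun i => ⟨s i, hs i⟩
    have hse : exponent (fun i => (⟨s i, hs i⟩ : Fin (p ^ n))) = s := by ext i; rfl
    rwa [hse] at this
  · intro h
    refine Finset.sum_eq_zero fun α _ => ?_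
    rw [h _ fun i => (α i).2, zero_smul]

theorem evalPoly_eq_zero_of_mem {n k : ℕ} (hk : d * p ^ n < k) {P : MvPolynomial (Fin d) E}
    (hP : P ∈ MvPolynomial.idealOfVars (Fin d) E ^ k) : evalPoly E g (N n) P = 0 := by
  rw [hgN.evalPoly_eq_zero_iff]
  intro s hs
  refine (MvPolynomial.mem_pow_idealOfVars_iff' k P).1 hP s (lt_of_le_of_lt ?_ hk)
  rw [Finsupp.degree_eq_sum]
  simpa using Finset.sum_le_sum fun i (_ : i ∈ Finset.univ) => (hs i).le

theorem exists_forall_evalPoly_eq_zero (M : OpenSubgroup G) : ∃ K, K ≠ 0 ∧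
    ∀ P ∈ MvPolynomial.idealOfVars (Fin d) E ^ K, evalPoly E g M P = 0 := by
  obtain ⟨n, hn⟩ := hgN.exists_le M
  -- A monomial of degree above `d * p ^ n` has an exponent of at least `p ^ n`. The bound has to be
  -- nonzero for the truncation of 1 to be 1 in `evalSeries`.
  refine ⟨d * p ^ n + 1, Nat.succ_ne_zero _, fun P hP => ?_⟩
  rw [← transition_evalPoly g hn, hgN.evalPoly_eq_zero_of_mem (Nat.lt_succ_self _) hP, map_zero]

omit [Fact p.Prime] [CharP E p] hgN in
theorem evalPoly_truncTotal_eq {M : OpenSubgroup G} {K K' : ℕ}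
    (hK : ∀ P ∈ MvPolynomial.idealOfVars (Fin d) E ^ K, evalPoly E g M P = 0)
    (hK' : ∀ P ∈ MvPolynomial.idealOfVars (Fin d) E ^ K', evalPoly E g M P = 0)
    (F : MvPowerSeries (Fin d) E) :
    evalPoly E g M (F.truncTotal K) = evalPoly E g M (F.truncTotal K') := by
  rw [← sub_eq_zero, ← map_sub]
  rcases le_total K K' with h | h
  · exact hK _ (MvPowerSeries.truncTotal_sub_truncTotal_mem_pow_idealOfVars le_rfl h F)
  · exact hK' _ (MvPowerSeries.truncTotal_sub_truncTotal_mem_pow_idealOfVars h le_rfl F)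

/-- The morphism `E[[X_1, ..., X_d]] → E[[G]]` that sends `X_i` to `g i - 1`. -/
noncomputable def evalSeries (E : Type*) [Field E] [CharP E p] :
    MvPowerSeries (Fin d) E →+* IwasawaAlgebra E G where
  toFun F := ⟨fun M => evalPoly E g M
      (F.truncTotal (hgN.exists_forall_evalPoly_eq_zero (E := E) M).choose), fun M M' h => by
    rw [transition_evalPoly]
    refine evalPoly_truncTotal_eq (fun P hP => ?_)
      (hgN.exists_forall_evalPoly_eq_zero (E := E) M').choose_spec.2 F
    rw [← transition_evalPoly g h,
      (hgN.exists_forall_evalPoly_eq_zero (E := E) M).choose_spec.2 P hP, map_zero]⟩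
  map_one' := by
    ext1; funext M
    change evalPoly E g M (MvPowerSeries.truncTotal _ 1) = 1
    rw [MvPowerSeries.truncTotal_one
      (hgN.exists_forall_evalPoly_eq_zero (E := E) M).choose_spec.1, map_one]
  map_mul' F F' := by
    ext1; funext M
    change evalPoly E g M (MvPowerSeries.truncTotal _ _) =
      evalPoly E g M (MvPowerSeries.truncTotal _ _) * evalPoly E g M (MvPowerSeries.truncTotal _ _)
    rw [← map_mul, ← sub_eq_zero, ← map_sub]
    exact (hgN.exists_forall_evalPoly_eq_zero (E := E) M).choose_spec.2 _
      (MvPowerSeries.truncTotal_mul_sub_mul_truncTotal_mem_pow_idealOfVars F F')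
  map_zero' := by
    ext1; funext M
    change evalPoly E g M (MvPowerSeries.truncTotal _ 0) = 0
    rw [map_zero, map_zero]
  map_add' F F' := by
    ext1; funext M
    change evalPoly E g M (MvPowerSeries.truncTotal _ _) =
      evalPoly E g M (MvPowerSeries.truncTotal _ _) + evalPoly E g M (MvPowerSeries.truncTotal _ _)
    rw [map_add, map_add]

theorem proj_evalSeries (n : ℕ) (F : MvPowerSeries (Fin d) E) :
    IwasawaAlgebra.proj E (N n) (hgN.evalSeries E F) =
      evalPoly E g (N n) (F.truncTotal (d * p ^ n + 1)) :=
  evalPoly_truncTotal_eq (hgN.exists_forall_evalPoly_eq_zero (E := E) (N n)).choose_spec.2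
    (fun _ hP => hgN.evalPoly_eq_zero_of_mem (Nat.lt_succ_self _) hP) F

theorem proj_evalSeries_eq_iff (n : ℕ) (F : MvPowerSeries (Fin d) E)
    (P : MvPolynomial (Fin d) E) :
    IwasawaAlgebra.proj E (N n) (hgN.evalSeries E F) = evalPoly E g (N n) P ↔
      ∀ s : Fin d →₀ ℕ, (∀ i, s i < p ^ n) → F.coeff s = P.coeff s := by
  rw [hgN.proj_evalSeries, ← sub_eq_zero, ← map_sub, hgN.evalPoly_eq_zero_iff]
  refine forall_congr' fun s => imp_congr_right fun hs => ?_
  rw [MvPolynomial.coeff_sub, sub_eq_zero, MvPowerSeries.coeff_truncTotal]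
  rw [Nat.lt_succ_iff, Finsupp.degree_eq_sum]
  simpa using Finset.sum_le_sum fun i (_ : i ∈ Finset.univ) => (hs i).le

omit hgN in
theorem apply_lt_pow {n : ℕ} {s : Fin d →₀ ℕ} (hn : degree s ≤ n) (i : Fin d) : s i < p ^ n :=
  ((Finsupp.le_degree i s).trans hn).trans_lt (Nat.lt_pow_self (Fact.out : p.Prime).one_lt)

theorem coeff_eq_zero_of_proj_eq_zero {n : ℕ} {F : MvPowerSeries (Fin d) E}
    (h : IwasawaAlgebra.proj E (N n) (hgN.evalSeries E F) = 0) {s : Fin d →₀ ℕ}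
    (hs : ∀ i, s i < p ^ n) : F.coeff s = 0 := by
  rw [← map_zero (evalPoly E g (N n)), hgN.proj_evalSeries_eq_iff] at h
  simpa using h s hs

theorem evalSeries_injective : Function.Injective (hgN.evalSeries E) := by
  rw [injective_iff_map_eq_zero]
  intro F hF
  ext s
  exact hgN.coeff_eq_zero_of_proj_eq_zero (n := degree s) (by rw [hF, map_zero])
    (apply_lt_pow le_rfl)

theorem evalSeries_surjective : Function.Surjective (hgN.evalSeries E) := by
  intro y
  choose P hP using fun n => hgN.evalPoly_surjective n (IwasawaAlgebra.proj E (N n) y)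
  have hcomp : ∀ m n, m ≤ n → ∀ s : Fin d →₀ ℕ, (∀ i, s i < p ^ m) →
      (P n).coeff s = (P m).coeff s := by
    intro m n hmn s hs
    have h : evalPoly E g (N m) (P n - P m) = 0 := by
      rw [map_sub, hP, ← transition_evalPoly g (hgN.anti hmn), hP,
        IwasawaAlgebra.transition_proj, sub_self]
    rw [hgN.evalPoly_eq_zero_iff] at h
    simpa [sub_eq_zero] using h s hs
  -- Level `degree s` determines the coefficient at `s`, because all exponents of `s` are less than
  -- `p ^ degree s`; `hcomp` makes the levels agree.
  let F : MvPowerSeries (Fin d) E := fun s => (P (degree s)).coeff s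
  refine ⟨F, IwasawaAlgebra.ext_proj E fun M => ?_⟩
  obtain ⟨n, hn⟩ := hgN.exists_le M
  rw [← IwasawaAlgebra.transition_proj E hn, ← IwasawaAlgebra.transition_proj E hn y, ← hP,
    (hgN.proj_evalSeries_eq_iff n _ _).2]
  intro s hs
  change (P (degree s)).coeff s = _
  rcases le_total n (degree s) with h | h
  · exact hcomp _ _ h s hs
  · exact (hcomp _ _ h s (apply_lt_pow le_rfl)).symm

/-- The isomorphism `E[[X_1, ..., X_d]] ≃ E[[G]]`. -/
noncomputable def ringEquiv (E : Type*) [Field E] [CharP E p] :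
    MvPowerSeries (Fin d) E ≃+* IwasawaAlgebra E G :=
  RingEquiv.ofBijective (hgN.evalSeries E) ⟨hgN.evalSeries_injective, hgN.evalSeries_surjective⟩

theorem isDomain (E : Type*) [Field E] [CharP E p] : IsDomain (IwasawaAlgebra E G) :=
  have : IsDomain (MvPowerSeries (Fin d) E) := NoZeroDivisors.to_isDomain _
  MulEquiv.isDomain _ (hgN.ringEquiv E).symm.toMulEquiv

theorem isNoetherianRing (E : Type*) [Field E] [CharP E p] :
    IsNoetherianRing (IwasawaAlgebra E G) :=
  isNoetherianRing_of_ringEquiv _ (hgN.ringEquiv E)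

theorem isLocalRing (E : Type*) [Field E] [CharP E p] : IsLocalRing (IwasawaAlgebra E G) :=
  (hgN.ringEquiv E).isLocalRing

theorem height_maximalIdeal [IsLocalRing (IwasawaAlgebra E G)] :
    (maximalIdeal (IwasawaAlgebra E G)).height = d := by
  have := IsLocalRing.maximalIdeal_height_eq_ringKrullDim (R := IwasawaAlgebra E G)
  rw [← ringKrullDim_eq_of_ringEquiv (hgN.ringEquiv E), MvPowerSeries.ringKrullDim_fin] at this
  exact_mod_cast this

/-- Degree less than `k` forces all exponents below `p ^ k`, so the kernel of the projection only
contains series without terms of degree less than `k`. -/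
theorem mem_maximalIdeal_pow [IsLocalRing (IwasawaAlgebra E G)] (k : ℕ)
    {x : IwasawaAlgebra E G} (hx : IwasawaAlgebra.proj E (N k) x = 0) :
    x ∈ maximalIdeal (IwasawaAlgebra E G) ^ k := by
  obtain ⟨F, rfl⟩ := hgN.evalSeries_surjective x
  have h1 : (maximalIdeal (MvPowerSeries (Fin d) E)).map (hgN.evalSeries E) ≤
      maximalIdeal (IwasawaAlgebra E G) := by
    rw [Ideal.map_le_iff_le_comap]
    intro a ha
    rw [Ideal.mem_comap, mem_maximalIdeal, mem_nonunits_iff]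
    intro h
    exact (mem_maximalIdeal _).1 ha ((MulEquiv.isUnit_map (hgN.ringEquiv E)).1 h)
  refine Ideal.pow_right_mono h1 k ?_
  rw [← Ideal.map_pow, MvPowerSeries.maximalIdeal_eq_span_X]
  exact Ideal.mem_map_of_mem _ (MvPowerSeries.mem_span_X_pow fun s hs =>
    hgN.coeff_eq_zero_of_proj_eq_zero hx (apply_lt_pow hs.le))

end IsPadicBasis

theorem IwasawaAlgebra.of_sub_one_mem_maximalIdeal [IsLocalRing (IwasawaAlgebra E G)] (h : G) :
    IwasawaAlgebra.of E h - 1 ∈ maximalIdeal (IwasawaAlgebra E G) := by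
  -- The augmentation, read on the trivial quotient: it kills `h - 1`, which is therefore not a
  -- unit.
  let ε : MonoidAlgebra E (G ⧸ (⊤ : OpenSubgroup G).toSubgroup) →ₐ[E] E := MonoidAlgebra.lift E E _ 1
  have h0 : ε (IwasawaAlgebra.proj E (⊤ : OpenSubgroup G) (IwasawaAlgebra.of E h - 1)) = 0 := by
    rw [map_sub, map_one, IwasawaAlgebra.proj_of, map_sub, map_one]
    simp [ε]
  refine (mem_maximalIdeal _).2 fun hu => ?_
  have := (hu.map (IwasawaAlgebra.proj E (⊤ : OpenSubgroup G))).map ε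
  rw [h0] at this
  exact not_isUnit_zero this

end PadicBasis

end Iwasawa

/-! ### The `p`-adic basis of a group isomorphic to `ℤ_p ^ d`. -/

namespace Iwasawa

section PadicModule

variable {p : ℕ} [Fact p.Prime] {d : ℕ}

theorem exists_forall_mem_span_pow_imp {S : Set (Fin d → ℤ_[p])} (hS : IsOpen S) (h0 : 0 ∈ S) :
    ∃ n : ℕ, ∀ z : Fin d → ℤ_[p], (∀ i, z i ∈ Ideal.span {(p : ℤ_[p]) ^ n}) → z ∈ S := by
  obtain ⟨ε, hε, hball⟩ := Metric.isOpen_iff.1 hS 0 h0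
  obtain ⟨n, hn⟩ := PadicInt.exists_pow_neg_lt p hε
  refine ⟨n, fun z hz => hball ?_⟩
  rw [mem_ball_zero_iff]
  refine lt_of_le_of_lt ?_ hn
  rw [pi_norm_le_iff_of_nonneg (by positivity)]
  exact fun i => (PadicInt.norm_le_pow_iff_mem_span_pow _ _).2 (hz i)

variable {G : Type*} [CommGroup G] [TopologicalSpace G]
  (e : Multiplicative (Fin d → ℤ_[p]) ≃ₜ* G)

/-- The reduction of the coordinates modulo `p ^ n`. -/
noncomputable def reduction (n : ℕ) : G →* Multiplicative (Fin d → ZMod (p ^ n)) :=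
  (AddMonoidHom.toMultiplicative
    (AddMonoidHom.compLeft (PadicInt.toZModPow n : ℤ_[p] →+* ZMod (p ^ n)).toAddMonoidHom
      (Fin d))).comp e.symm.toMonoidHom

theorem reduction_apply (n : ℕ) (h : G) (i : Fin d) :
    (reduction e n h).toAdd i = PadicInt.toZModPow n ((e.symm h).toAdd i) := rfl

theorem mem_ker_reduction_iff (n : ℕ) (h : G) :
    h ∈ (reduction e n).ker ↔
      ∀ i, (e.symm h).toAdd i ∈ Ideal.span {(p : ℤ_[p]) ^ n} := by
  rw [MonoidHom.mem_ker, ← toAdd_eq_zero, funext_iff]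
  refine forall_congr' fun i => ?_
  rw [reduction_apply, ← PadicInt.ker_toZModPow, RingHom.mem_ker]
  rfl

/-- The subgroup of the elements with coordinates in `p ^ n ℤ_p`. -/
noncomputable def powSubgroup (n : ℕ) : OpenSubgroup G where
  toSubgroup := (reduction e n).ker
  isOpen' := by
    have h1 : IsOpen {z : ℤ_[p] | z ∈ Ideal.span {(p : ℤ_[p]) ^ n}} := by
      have : {z : ℤ_[p] | z ∈ Ideal.span {(p : ℤ_[p]) ^ n}} =
          Metric.closedBall 0 ((p : ℝ) ^ (-n : ℤ)) := by
        ext z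
        rw [mem_closedBall_zero_iff, PadicInt.norm_le_pow_iff_mem_span_pow]
        rfl
      rw [this]
      exact IsUltrametricDist.isOpen_closedBall _ (by
        have := (Fact.out : p.Prime).pos
        positivity)
    have h2 : ((reduction e n).ker : Set G) = ⋂ i, (fun h => (e.symm h).toAdd i) ⁻¹'
        {z : ℤ_[p] | z ∈ Ideal.span {(p : ℤ_[p]) ^ n}} := by
      ext h
      rw [SetLike.mem_coe, mem_ker_reduction_iff]
      simp
    change IsOpen ((reduction e n).ker : Set G)
    rw [h2]
    refine isOpen_iInter_of_finite fun i => h1.preimage ?_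
    exact (continuous_apply i).comp (continuous_toAdd.comp e.symm.continuous)

/-- The elements of the standard basis. -/
noncomputable def padicGen (i : Fin d) : G := e (Multiplicative.ofAdd (Pi.single i 1))

theorem isPadicBasis : IsPadicBasis p (padicGen e) (powSubgroup e) where
  pow_mem n i := by
    change _ ∈ (reduction e n).ker
    rw [MonoidHom.mem_ker, map_pow, ← toAdd_eq_zero, toAdd_pow]
    funext j
    rw [Pi.smul_apply, nsmul_eq_mul]
    simp
  exists_prod n h := by
    refine ⟨fun i => ((reduction e n h).toAdd i).val, ?_⟩
    change _ ∈ (reduction e n).ker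
    rw [MonoidHom.mem_ker, map_mul, map_inv, inv_mul_eq_one, map_prod]
    apply Multiplicative.toAdd.injective
    rw [toAdd_prod]
    funext j
    have : NeZero (p ^ n) := ⟨pow_ne_zero _ (Fact.out : p.Prime).ne_zero⟩
    have hone : ∀ i, (reduction e n (padicGen e i)).toAdd j = if i = j then 1 else 0 := by
      intro i
      rw [reduction_apply, padicGen, ContinuousMulEquiv.symm_apply_apply, toAdd_ofAdd,
        Pi.single_apply]
      split_ifs with h1 h2 h2
      · simp
      · exact absurd h1.symm h2
      · exact absurd h2.symm h1
      · simp
    have hpow : ∀ (i : Fin d) (k : ℕ), (reduction e n (padicGen e i ^ k)).toAdd j =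
        if i = j then (k : ZMod (p ^ n)) else 0 := by
      intro i k
      rw [map_pow, toAdd_pow, Pi.smul_apply, hone, nsmul_eq_mul, mul_ite, mul_one, mul_zero]
    rw [Finset.sum_apply, Finset.sum_congr rfl fun i _ => hpow i _]
    simp
  card n := by
    have hs : Function.Surjective (reduction e n) := by
      intro y
      choose z hz using fun i => ZMod.ringHom_surjective (PadicInt.toZModPow n) (y.toAdd i)
      refine ⟨e (Multiplicative.ofAdd z), Multiplicative.toAdd.injective (funext fun i => ?_)⟩
      rw [reduction_apply, ContinuousMulEquiv.symm_apply_apply]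
      exact hz i
    change Nat.card (G ⧸ (reduction e n).ker) = _
    rw [Nat.card_congr (QuotientGroup.quotientKerEquivOfSurjective _ hs).toEquiv,
      Nat.card_congr Multiplicative.toAdd, Nat.card_fun, Nat.card_zmod, Nat.card_fin, ← pow_mul,
      mul_comm]
  anti := by
    intro m n hmn h hh
    change h ∈ (reduction e m).ker
    replace hh : h ∈ (reduction e n).ker := hh
    rw [mem_ker_reduction_iff] at hh ⊢
    exact fun i => Ideal.span_singleton_le_span_singleton.2 (pow_dvd_pow _ hmn) (hh i)
  exists_le M := by
    obtain ⟨n, hn⟩ := exists_forall_mem_span_pow_imp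
      (S := (fun z => e (Multiplicative.ofAdd z)) ⁻¹' (M : Set G))
      (M.isOpen.preimage (e.continuous.comp continuous_ofAdd)) (by
        change e 1 ∈ (M : Set G)
        rw [map_one]
        exact one_mem M)
    refine ⟨n, fun h hh => ?_⟩
    replace hh : h ∈ (reduction e n).ker := hh
    rw [mem_ker_reduction_iff] at hh
    have := hn _ hh
    simpa using this

end PadicModule

end Iwasawa

/-! ### Coordinates on `U` and on `Γ`. -/

namespace Iwasawa

section Concrete

variable (p : ℕ) [Fact p.Prime] (F : Type*) [NormedField F] [NormedAlgebra ℚ_[p] F]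
  [FiniteDimensional ℚ_[p] F] [Algebra ℤ_[p] F] [IsScalarTower ℤ_[p] ℚ_[p] F]

theorem finite_OF : Module.Finite ℤ_[p] (OF p F) := by
  have := IsIntegralClosure.isNoetherian ℤ_[p] ℚ_[p] F (OF p F)
  infer_instance

omit [FiniteDimensional ℚ_[p] F] in
theorem continuous_algebraMap_padicInt : Continuous (algebraMap ℤ_[p] F) := by
  rw [IsScalarTower.algebraMap_eq ℤ_[p] ℚ_[p] F]
  exact (continuous_algebraMap ℚ_[p] F).comp continuous_subtype_val

theorem exists_basis_OF :
    Nonempty (Module.Basis (Fin (Module.finrank ℚ_[p] F)) ℤ_[p] (OF p F)) := by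
  have : Module.IsTorsionFree ℤ_[p] F := .trans_faithfulSMul ℤ_[p] ℚ_[p] F
  have := finite_OF p F
  have hfree : Module.Free ℤ_[p] (OF p F) := IsIntegralClosure.module_free ℤ_[p] ℚ_[p] F (OF p F)
  rw [← IsIntegralClosure.rank ℤ_[p] ℚ_[p] F (OF p F)]
  exact ⟨Module.finBasis ℤ_[p] (OF p F)⟩

omit [NormedAlgebra ℚ_[p] F] [FiniteDimensional ℚ_[p] F] [IsScalarTower ℤ_[p] ℚ_[p] F] in
theorem continuous_unip : Continuous (unip : F → GL (Fin 2) F) := by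
  have h1 : Continuous fun x : F => !![1, x; 0, 1] := by fun_prop
  have h2 : ∀ x : F, ((unip x)⁻¹ : GL (Fin 2) F) = unip (-x) := fun x =>
    inv_eq_of_mul_eq_one_right (by rw [unip_mul, add_neg_cancel, unip_zero])
  refine Units.continuous_iff.2 ⟨h1, ?_⟩
  simp only [h2]
  exact h1.comp continuous_neg

theorem unip_injective {F : Type*} [Field F] : Function.Injective (unip : F → GL (Fin 2) F) := by
  intro x y h
  have := congrArg (fun g : GL (Fin 2) F => (g : Matrix (Fin 2) (Fin 2) F) 0 1) h
  simpa [unip, Matrix.GeneralLinearGroup.mkOfDetNeZero] using this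

instance : IsTopologicalGroup (U p F) :=
  inferInstanceAs (IsTopologicalGroup (U p F : Subgroup (GL (Fin 2) F)))

omit [FiniteDimensional ℚ_[p] F] in
theorem continuous_equivFun_symm {d : ℕ} (b : Module.Basis (Fin d) ℤ_[p] (OF p F)) :
    Continuous fun z : Fin d → ℤ_[p] => ((b.equivFun.symm z : OF p F) : F) := by
  have : ∀ z : Fin d → ℤ_[p], ((b.equivFun.symm z : OF p F) : F) =
      ∑ i, algebraMap ℤ_[p] F (z i) * (b i : F) := by
    intro z
    rw [Module.Basis.equivFun_symm_apply]
    simp [Algebra.smul_def]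
  simp only [this]
  have := continuous_algebraMap_padicInt p F
  fun_prop

theorem exists_continuousMulEquiv_U :
    Nonempty (Multiplicative (Fin (Module.finrank ℚ_[p] F) → ℤ_[p]) ≃ₜ* U p F) := by
  obtain ⟨b⟩ := exists_basis_OF p F
  let f : Multiplicative (Fin (Module.finrank ℚ_[p] F) → ℤ_[p]) →* U p F :=
    { toFun := fun z => ⟨unip (b.equivFun.symm z.toAdd : OF p F), _, Subtype.property _, rfl⟩
      map_one' := Subtype.ext (by
        rw [toAdd_one, map_zero]
        exact unip_zero)
      map_mul' := fun z w => Subtype.ext (by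
        rw [toAdd_mul, map_add]
        exact (unip_mul _ _).symm) }
  have hf : Function.Bijective f := by
    constructor
    · intro z w h
      have h1 := unip_injective (congrArg Subtype.val h)
      exact Multiplicative.toAdd.injective (b.equivFun.symm.injective (Subtype.ext h1))
    · rintro ⟨_, x, hx, rfl⟩
      refine ⟨Multiplicative.ofAdd (b.equivFun ⟨x, hx⟩), Subtype.ext ?_⟩
      change unip ((b.equivFun.symm (b.equivFun ⟨x, hx⟩) : OF p F) : F) = unip x
      rw [LinearEquiv.symm_apply_apply]
  have hcont : Continuous f := by
    refine Continuous.subtype_mk ?_ _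
    exact (continuous_unip F).comp ((continuous_equivFun_symm p F b).comp continuous_toAdd)
  let e := MulEquiv.ofBijective f hf
  exact ⟨{ e with
    continuous_toFun := hcont
    continuous_invFun := (Continuous.homeoOfEquivCompactToT2 (f := e.toEquiv) hcont).symm.continuous }⟩

omit [NormedAlgebra ℚ_[p] F] [FiniteDimensional ℚ_[p] F] [IsScalarTower ℤ_[p] ℚ_[p] F] in
theorem exists_unit_eq (x : OF p F) : ∃ a : Fˣ, (a : F) = 1 + p * (x : F) := by
  obtain ⟨v, hv⟩ := isUnit_one_add_p_mul p x
  refine ⟨v.map (OF p F).val.toMonoidHom, ?_⟩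
  change ((v : OF p F) : F) = _
  rw [hv]
  simp

/-- The element `(1 + p x, 0; 0, 1)` of `Γ`. -/
noncomputable def gammaOf (x : OF p F) : Γ p F :=
  ⟨diag (exists_unit_eq p F x).choose, _, ⟨x, x.2, (exists_unit_eq p F x).choose_spec⟩, rfl⟩

omit [NormedAlgebra ℚ_[p] F] [FiniteDimensional ℚ_[p] F] [IsScalarTower ℤ_[p] ℚ_[p] F] in
theorem continuous_gammaOf : Continuous (gammaOf p F) := by
  have hu : Continuous fun x : OF p F => (exists_unit_eq p F x).choose := by
    rw [Units.isEmbedding_val₀.continuous_iff]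
    have : (Units.val ∘ fun x : OF p F => (exists_unit_eq p F x).choose) =
        fun x : OF p F => 1 + p * (x : F) := funext fun x => (exists_unit_eq p F x).choose_spec
    rw [this]
    fun_prop
  have hd : Continuous (diag : Fˣ → GL (Fin 2) F) := by
    have h1 : Continuous fun a : Fˣ => !![(a : F), 0; 0, 1] := by
      have := Units.continuous_val (M := F)
      fun_prop
    have h2 : ∀ a : Fˣ, ((diag a)⁻¹ : GL (Fin 2) F) = diag a⁻¹ := fun a =>
      inv_eq_of_mul_eq_one_right (by rw [diag_mul, mul_inv_cancel, diag_one])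
    refine Units.continuous_iff.2 ⟨h1, ?_⟩
    simp only [h2]
    exact h1.comp continuous_inv
  exact (hd.comp hu).subtype_mk _

omit [NormedAlgebra ℚ_[p] F] [FiniteDimensional ℚ_[p] F] [IsScalarTower ℤ_[p] ℚ_[p] F] in
theorem conj_gammaOf (x y : OF p F) (h : unip (y : F) ∈ U p F) :
    (conj p F (gammaOf p F x) ⟨unip (y : F), h⟩ : GL (Fin 2) F) =
      unip ((y : F) + p * x * y) := by
  change diag (exists_unit_eq p F x).choose * unip (y : F) *
    (diag (exists_unit_eq p F x).choose)⁻¹ = _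
  rw [diag_mul_unip, mul_inv_cancel_right, (exists_unit_eq p F x).choose_spec, add_mul, one_mul]

/-- In coordinates on `O_F`, `gammaOf` is continuous and sends 0 to 1, so a neighborhood `p ^ r O_F`
of 0 lands in the open subgroup. -/
theorem exists_gammaOf_mem (Γ' : OpenSubgroup (Γ p F)) :
    ∃ r : ℕ, ∀ y : OF p F, gammaOf p F (p ^ r * y) ∈ Γ' := by
  obtain ⟨b⟩ := exists_basis_OF p F
  have hcont : Continuous fun z => gammaOf p F (b.equivFun.symm z) :=
    (continuous_gammaOf p F).comp ((continuous_equivFun_symm p F b).subtype_mk _)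
  obtain ⟨r, hr⟩ := exists_forall_mem_span_pow_imp (Γ'.isOpen.preimage hcont) (by
    have : gammaOf p F (b.equivFun.symm 0) = 1 := by
      apply Subtype.ext
      have h0 : (exists_unit_eq p F (b.equivFun.symm 0)).choose = 1 := by
        ext
        rw [(exists_unit_eq p F (b.equivFun.symm 0)).choose_spec]
        simp
      change diag (exists_unit_eq p F (b.equivFun.symm 0)).choose = 1
      rw [h0, diag_one]
    rw [Set.mem_preimage, this]
    exact one_mem Γ')
  refine ⟨r, fun y => ?_⟩
  have h1 : (p ^ r * y : OF p F) = b.equivFun.symm ((p : ℤ_[p]) ^ r • b.equivFun y) := by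
    rw [map_smul, LinearEquiv.symm_apply_apply, Algebra.smul_def]
    simp
  rw [h1]
  exact hr _ fun i => Ideal.mem_span_singleton'.2 ⟨b.equivFun y i, by
    rw [Pi.smul_apply, smul_eq_mul, mul_comm]⟩

/-- Some nonzero `c ∈ ℤ_p` makes `c x⁻¹` integral; dividing by the unit part of `c` leaves a power
of `p`. This provides the richness hypothesis of `exists_maximalIdeal_pow_le`. -/
theorem exists_mul_eq_pow {x : OF p F} (hx : x ≠ 0) : ∃ (k : ℕ) (y : OF p F), y * x = p ^ k := by
  have halg : IsAlgebraic ℤ_[p] ((x : F)⁻¹) := by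
    rw [IsFractionRing.isAlgebraic_iff ℤ_[p] ℚ_[p] F]
    exact Algebra.IsAlgebraic.isAlgebraic _
  obtain ⟨c, hc0, hc⟩ := halg.exists_integral_multiple
  have hx' : (x : F) ≠ 0 := fun h => hx (Subtype.ext h)
  refine ⟨c.valuation,
    algebraMap ℤ_[p] (OF p F) ↑(PadicInt.unitCoeff hc0)⁻¹ * ⟨c • (x : F)⁻¹, hc⟩, Subtype.ext ?_⟩
  have h1 : c = (PadicInt.unitCoeff hc0 : ℤ_[p]) * (p : ℤ_[p]) ^ c.valuation :=
    PadicInt.unitCoeff_spec hc0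
  have h2 : (↑(PadicInt.unitCoeff hc0)⁻¹ : ℤ_[p]) * c = (p : ℤ_[p]) ^ c.valuation := by
    rw [Units.inv_mul_eq_iff_eq_mul]
    exact h1
  change algebraMap ℤ_[p] F ↑(PadicInt.unitCoeff hc0)⁻¹ * (c • (x : F)⁻¹) * x =
    ((p ^ c.valuation : OF p F) : F)
  rw [Algebra.smul_def, ← mul_assoc, ← map_mul, h2, mul_assoc, inv_mul_cancel₀ hx', mul_one]
  simp

theorem unip_pow {F : Type*} [Field F] (x : F) (n : ℕ) : unip x ^ n = unip (n * x) := by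
  induction n with
  | zero => simp [unip_zero]
  | succ n ih => rw [pow_succ, ih, unip_mul, Nat.cast_succ, add_mul, one_mul]

end Concrete

end Iwasawa

/-! ### Open ideals, stable ideals of `E[[U]]` and the conclusion. -/

namespace Iwasawa

namespace IwasawaAlgebra

variable {E : Type*} [Field E] {G : Type*} [CommGroup G] [TopologicalSpace G]

theorem isOpen_ideal_of_forall_proj_eq_zero {I : Ideal (IwasawaAlgebra E G)} (N : OpenSubgroup G)
    (h : ∀ x, proj E N x = 0 → x ∈ I) : IsOpen (I : Set (IwasawaAlgebra E G)) := by
  have h1 : (I : Set (IwasawaAlgebra E G)) =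
      (fun x : IwasawaAlgebra E G => x.1 N) ⁻¹' ((fun x : IwasawaAlgebra E G => x.1 N) '' (I : Set (IwasawaAlgebra E G))) := by
    refine Set.Subset.antisymm (Set.subset_preimage_image _ _) ?_
    rintro x ⟨y, hy, hxy⟩
    have : x - y ∈ I := h _ (by rw [map_sub, sub_eq_zero]; exact hxy.symm)
    simpa using I.add_mem this hy
  have h2 : @IsOpen _
      (TopologicalSpace.induced (fun x : IwasawaAlgebra E G => x.1 N) ⊥)
      (I : Set (IwasawaAlgebra E G)) := ⟨_, trivial, h1.symm⟩
  exact iInf_le (fun N : OpenSubgroup G =>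
    TopologicalSpace.induced (fun x : IwasawaAlgebra E G => x.1 N) ⊥) N _ h2

theorem exists_forall_proj_eq_zero_of_isOpen {s : Set (IwasawaAlgebra E G)} (hs : IsOpen s)
    (h0 : 0 ∈ s) : ∃ N : OpenSubgroup G, ∀ x, proj E N x = 0 → x ∈ s := by
  have h1 : s ∈ nhds (0 : IwasawaAlgebra E G) := hs.mem_nhds h0
  have h2 : nhds (0 : IwasawaAlgebra E G) =
      ⨅ N : OpenSubgroup G, Filter.principal {x : IwasawaAlgebra E G | proj E N x = 0} := by
    change @nhds _ (⨅ N : OpenSubgroup G,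
      TopologicalSpace.induced (fun x : IwasawaAlgebra E G => x.1 N) ⊥) 0 = _
    rw [nhds_iInf]
    refine iInf_congr fun N => ?_
    let _ : TopologicalSpace (MonoidAlgebra E (G ⧸ N.toSubgroup)) := ⊥
    have : DiscreteTopology (MonoidAlgebra E (G ⧸ N.toSubgroup)) := ⟨rfl⟩
    rw [nhds_induced, nhds_discrete, Filter.comap_pure]
    rfl
  rw [h2, Filter.mem_iInf_of_directed] at h1
  · exact h1
  · intro N M
    refine ⟨N ⊓ M, ?_, ?_⟩
    · refine Filter.principal_mono.2 fun x (hx : proj E _ x = 0) => ?_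
      change proj E N x = 0
      rw [← transition_proj E (inf_le_left : N ⊓ M ≤ N), hx, map_zero]
    · refine Filter.principal_mono.2 fun x (hx : proj E _ x = 0) => ?_
      change proj E M x = 0
      rw [← transition_proj E (inf_le_right : N ⊓ M ≤ M), hx, map_zero]

/-- In an Iwasawa algebra that is a domain but not a field, with all `G ⧸ N` finite, the zero ideal is not open. -/
theorem ne_bot_of_isOpen [IsDomain (IwasawaAlgebra E G)]
    (hfin : ∀ N : OpenSubgroup G, Finite (G ⧸ N.toSubgroup))
    (hA : ¬ IsField (IwasawaAlgebra E G)) {I : Ideal (IwasawaAlgebra E G)}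
    (hI : IsOpen (I : Set (IwasawaAlgebra E G))) : I ≠ ⊥ := by
  rintro rfl
  obtain ⟨N, hN⟩ := exists_forall_proj_eq_zero_of_isOpen hI (zero_mem _)
  -- `E[[G]]` would embed in the finite-dimensional `E[G/N]`; a domain integral over a field is a
  -- field.
  have hinj : Function.Injective (proj E N).toLinearMap :=
    (injective_iff_map_eq_zero _).2 fun x hx => by simpa using hN x hx
  have := hfin N
  have : Module.Finite E (MonoidAlgebra E (G ⧸ N.toSubgroup)) :=
    Module.Finite.equiv (MonoidAlgebra.coeffLinearEquiv E).symm
  have : Module.Finite E (IwasawaAlgebra E G) := Module.Finite.of_injective _ hinj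
  exact hA (isField_of_isIntegral_of_isField' (Field.toIsField E))

end IwasawaAlgebra

section Concrete

open IsLocalRing IwasawaAlgebra

variable (p : ℕ) [Fact p.Prime] (F : Type*) [NormedField F] [NormedAlgebra ℚ_[p] F]
  [FiniteDimensional ℚ_[p] F] [Algebra ℤ_[p] F] [IsScalarTower ℤ_[p] ℚ_[p] F]

/-- The endomorphism `u ↦ u⁻¹ γ u γ⁻¹` of `U`. -/
def commutatorHom (γ : Γ p F) : U p F →ₜ* U p F where
  toFun u := u⁻¹ * conj p F γ u
  map_one' := by simp
  map_mul' u v := by rw [map_mul, mul_inv, mul_mul_mul_comm]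
  continuous_toFun := continuous_inv.mul (conj p F γ).continuous_toFun

omit [NormedAlgebra ℚ_[p] F] [FiniteDimensional ℚ_[p] F] [IsScalarTower ℤ_[p] ℚ_[p] F] in
theorem commutatorHom_gammaOf (x y : OF p F) (h : unip (y : F) ∈ U p F) :
    (commutatorHom p F (gammaOf p F x) ⟨unip (y : F), h⟩ : GL (Fin 2) F) =
      unip (p * x * y : F) := by
  change (unip (y : F))⁻¹ * (conj p F (gammaOf p F x) ⟨unip (y : F), h⟩ : GL (Fin 2) F) = _
  rw [conj_gammaOf, inv_mul_eq_iff_eq_mul, unip_mul]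

/-- On the coordinate `x` of `U`, the commutator with `gammaOf (p ^ r * y)` is multiplication by `p
^ (r + 1) * y`. It is additive in `y`, and when `y * x = p ^ k`, replacing `y` by `y * z` reaches `p
^ (r + 1 + k) * z` for any `z`. -/
theorem exists_maximalIdeal_pow_le_of_stable [CompactSpace (U p F)] (E : Type*) [Field E]
    [CharP E p] [IsNoetherianRing (IwasawaAlgebra E (U p F))]
    [IsLocalRing (IwasawaAlgebra E (U p F))]
    (hof : ∀ g, of E g - 1 ∈ maximalIdeal (IwasawaAlgebra E (U p F)))
    (hker : ∀ k, ∃ N : OpenSubgroup (U p F), ∀ x, proj E N x = 0 →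
      x ∈ maximalIdeal (IwasawaAlgebra E (U p F)) ^ k)
    (Γ' : OpenSubgroup (Γ p F)) (I : Ideal (IwasawaAlgebra E (U p F)))
    (hI : ∀ γ ∈ Γ', ∀ x ∈ I, map E (conj p F γ) x ∈ I) (hI0 : I ≠ ⊥) :
    ∃ k, maximalIdeal (IwasawaAlgebra E (U p F)) ^ k ≤ I := by
  obtain ⟨r, hr⟩ := exists_gammaOf_mem p F Γ'
  refine exists_maximalIdeal_pow_le p hof hker
    (fun y : OF p F => commutatorHom p F (gammaOf p F (p ^ r * y)))
    (fun y => conj p F (gammaOf p F (p ^ r * y))) ?_ ?_ ?_ ?_ I (fun y => hI _ (hr y)) hI0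
  · rintro ⟨_, x, hx, rfl⟩
    refine Subtype.ext ?_
    refine (commutatorHom_gammaOf p F _ ⟨x, hx⟩ _).trans ?_
    simp [unip_zero]
  · rintro y z ⟨_, x, hx, rfl⟩
    refine Subtype.ext ((commutatorHom_gammaOf p F _ ⟨x, hx⟩ _).trans ?_)
    refine Eq.trans ?_ (congrArg₂ (· * ·) (commutatorHom_gammaOf p F _ ⟨x, hx⟩ _)
      (commutatorHom_gammaOf p F _ ⟨x, hx⟩ _)).symm
    rw [unip_mul]
    congr 1
    push_cast
    ring
  · intro y g
    exact (mul_inv_cancel_left g _).symm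
  · rintro ⟨_, x, hx, rfl⟩ hg
    have hx0 : (⟨x, hx⟩ : OF p F) ≠ 0 := by
      rintro h0
      obtain rfl : x = 0 := congrArg Subtype.val h0
      exact hg (Subtype.ext unip_zero)
    obtain ⟨k, y, hy⟩ := exists_mul_eq_pow p F hx0
    have hy' : (y : F) * x = p ^ k := by simpa using congrArg Subtype.val hy
    refine ⟨r + 1 + k, ?_⟩
    rintro ⟨_, z, hz, rfl⟩
    refine ⟨y * ⟨z, hz⟩, Subtype.ext ((commutatorHom_gammaOf p F _ ⟨x, hx⟩ _).trans ?_)⟩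
    change _ = unip z ^ _
    rw [unip_pow]
    congr 1
    push_cast
    linear_combination (p : F) ^ (r + 1) * z * hy'

end Concrete

end Iwasawa

/-- Every minimal prime over `I` contains a power of the maximal ideal, hence the maximal ideal
itself. -/
theorem IsLocalRing.height_eq_of_maximalIdeal_pow_le {R : Type*} [CommRing R] [IsLocalRing R]
    {I : Ideal R} (hI : I ≠ ⊤) {k : ℕ} (hk : IsLocalRing.maximalIdeal R ^ k ≤ I) :
    I.height = (IsLocalRing.maximalIdeal R).height := by
  refine le_antisymm (Ideal.height_mono (IsLocalRing.le_maximalIdeal hI)) ?_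
  rw [Ideal.height_eq_inf_minimalPrimes I]
  refine le_iInf₂ fun J hJ => Ideal.height_mono ?_
  have := hJ.1.1
  exact Ideal.IsPrime.le_of_pow_le (hk.trans hJ.1.2)

open Iwasawa in
theorem mainTheorem1 (p : ℕ) [Fact p.Prime]
    (F : Type*) [NormedField F] [NormedAlgebra ℚ_[p] F] [FiniteDimensional ℚ_[p] F]
    [Algebra ℤ_[p] F] [IsScalarTower ℤ_[p] ℚ_[p] F]
    (E : Type*) [Field E] [CharP E p]
    (Γ' : OpenSubgroup (Iwasawa.Γ p F))
    (I : Ideal (Iwasawa.IwasawaAlgebra E (Iwasawa.U p F)))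
    (hI : ∀ γ ∈ Γ', ∀ x ∈ I, Iwasawa.IwasawaAlgebra.map E (Iwasawa.conj p F γ) x ∈ I) :
    (I ≠ ⊥ → IsOpen (I : Set (Iwasawa.IwasawaAlgebra E (Iwasawa.U p F)))) ∧
    (I ≠ ⊤ → I.height = 0 ∨ I.height = (Module.finrank ℚ_[p] F : ℕ∞)) ∧
    (I.height = 0 ↔ I = ⊥) ∧
    (I ≠ ⊤ → (I.height = (Module.finrank ℚ_[p] F : ℕ∞) ↔
      IsOpen (I : Set (Iwasawa.IwasawaAlgebra E (Iwasawa.U p F))))) := by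
  obtain ⟨e⟩ := exists_continuousMulEquiv_U p F
  have hb := isPadicBasis e
  have : CompactSpace (U p F) := e.toHomeomorph.compactSpace
  have := hb.isDomain E
  have := hb.isNoetherianRing E
  have := hb.isLocalRing E
  have hd : (Module.finrank ℚ_[p] F : ℕ∞) ≠ 0 := by
    exact_mod_cast Module.finrank_pos.ne'
  have hheight := hb.height_maximalIdeal (E := E)
  have hfield : ¬ IsField (IwasawaAlgebra E (U p F)) := fun h => by
    rw [IsLocalRing.isField_iff_maximalIdeal_eq.1 h, Ideal.height_bot] at hheight
    exact hd hheight.symm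
  have hopen0 : IsOpen (I : Set (IwasawaAlgebra E (U p F))) → I ≠ ⊥ :=
    IwasawaAlgebra.ne_bot_of_isOpen (fun N => inferInstance) hfield
  have hker : ∀ k, ∃ N : OpenSubgroup (U p F), ∀ x, IwasawaAlgebra.proj E N x = 0 →
      x ∈ IsLocalRing.maximalIdeal (IwasawaAlgebra E (U p F)) ^ k :=
    fun k => ⟨_, fun x => hb.mem_maximalIdeal_pow k⟩
  have hpow : I ≠ ⊥ → ∃ k, IsLocalRing.maximalIdeal _ ^ k ≤ I :=
    exists_maximalIdeal_pow_le_of_stable p F E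
      IwasawaAlgebra.of_sub_one_mem_maximalIdeal hker Γ' I hI
  have hopen : I ≠ ⊥ → IsOpen (I : Set (IwasawaAlgebra E (U p F))) := fun h => by
    obtain ⟨k, hk⟩ := hpow h
    obtain ⟨N, hN⟩ := hker k
    exact IwasawaAlgebra.isOpen_ideal_of_forall_proj_eq_zero N fun x hx => hk (hN x hx)
  have hIheight : I ≠ ⊥ → I ≠ ⊤ → I.height = (Module.finrank ℚ_[p] F : ℕ∞) := fun h h' => by
    obtain ⟨k, hk⟩ := hpow h
    rw [IsLocalRing.height_eq_of_maximalIdeal_pow_le h' hk, hheight]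
  have hzero : I.height = 0 ↔ I = ⊥ := Ideal.height_eq_zero_iff_eq_bot
  refine ⟨hopen, fun h => ?_, hzero, fun h => ⟨fun h1 => hopen fun h2 => ?_,
    fun h1 => hIheight (hopen0 h1) h⟩⟩
  · by_cases h0 : I = ⊥
    · exact Or.inl (hzero.2 h0)
    · exact Or.inr (hIheight h0 h)
  · exact hd (h1.symm.trans (hzero.2 h2))
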